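/- **Definitions.** Let $d\ge 1$, let $|\cdot|$ denote Lebesgue measure on $\mathbb R^d$, and for $\Omega\subset\mathbb R^d$ let $|g|_p$ be the norm of $g$ in $L_p(\Omega)$ (with the Euclidean norm for vector-valued $g$, and with value in $[0,\infty]$). *Data.* Let $\Omega\subset\mathbb R^d$ be open with $|\Omega|<\infty$, $f:\Omega\to\mathbb R^d$ Borel and $\varepsilon>0$. A pair $(A,u)$ is called a *Lusin pair* for $(\Omega,f,\varepsilon)$ if $A\subset\Omega$ is open, $|A|\le\varepsilon|\Omega|$, $u$ is a $C^1$ function with compact support in $\Omega$, and $Du=f$ on $\Omega\setminus A$. *The constant.* Let $K(d)\in[0,\infty]$ be the infimum of all $K\in[0,\infty]$ such that every $(\Omega,f,\varepsilon)$ as above has a Lusin pair $(A,u)$ with $$|Du|_p\le K\,\varepsilon^{1/p-1}\,|f|_p \qquad (1)$$ for all $p\in[1,\infty]$. *Grand Lebesgue spaces.* For $1\le a<b\le\infty$ let $\Psi(a,b)$ be the set of functions $\psi$ that are continuous and finite on $(a,b)$, satisfy $\inf_{(a,b)}\psi>0$, and are equal to $\infty$ off $(a,b)$. For $\psi\in\Psi(a,b)$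 and $\delta>0$ put $$\|g\|_{G(\psi)}=\sup_{p\in(a,b)}\frac{|g|_p}{\psi(p)},\qquad \varphi(G(\psi),\delta)=\sup_{p\in(a,b)}\frac{\delta^{1/p}}{\psi(p)},$$ and write $g\in G(\psi)$ if $g$ is measurable and $\|g\|_{G(\psi)}<\infty$. The function $\varphi(G(\psi),\cdot)$ is the fundamental function: $\varphi(G(\psi),\delta)$ is the $G(\psi)$-norm of the indicator of a set of measure $\delta$. **Theorem 2.1.** Let $d\ge1$. Then $0<K(d)<\infty$, and the following hold. 1. For all $\Omega,f,\varepsilon$ as above there is a Lusin pair $(A,u)$ that satisfies (1) with $K=K(d)$ for all $p\in[1,\infty]$. 2. Let $(A,u)$ be any Lusin pair for $(\Omega,f,\varepsilon)$ that satisfies (1) with $K=K(d)$ for all $p\in(1,\infty)$. Then for all $1\le a<b\le\infty$ and $\psi,\zeta\in\Psi(a,b)$ such that $f\in G(\psi)$, with $\nu=\zeta\psi$, $$\|Du\|_{G(\nu)}\le K(d)\,\varepsilon^{-1}\,\varphi(G(\zeta),\varepsilon)\,\|f\|_{G(\psi)}.$$ 3. The constant $K(d)$ is best possible: for every $0\le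 K<K(d)$ there are $\Omega,f,\varepsilon$ as above, $1\le a<b\le\infty$ and $\psi,\zeta\in\Psi(a,b)$ with $f\in G(\psi)$ such that, with $\nu=\zeta\psi$, every Lusin pair $(A,u)$ for $(\Omega,f,\varepsilon)$ satisfies $$\|Du\|_{G(\nu)}> K\,\varepsilon^{-1}\,\varphi(G(\zeta),\varepsilon)\,\|f\|_{G(\psi)}.$$ -/

import Mathlib

open MeasureTheory Set
open scoped ENNReal

/-- The class `Ψ(a, b)` of generating functions: `1 ≤ a < b ≤ ∞`, and `ψ` is finite exactly on the
open interval `(a, b)`, continuous there, and bounded below there by a positive constant. Exponents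
`p` are extended nonnegative reals; every `p ∈ (a, b)` is a real number greater than `1`. -/
structure IsPsiFunction (a b : ℝ≥0∞) (ψ : ℝ≥0∞ → ℝ≥0∞) : Prop where
  one_le : 1 ≤ a
  lt : a < b
  supp_eq : {p | ψ p < ∞} = Ioo a b
  continuousOn : ContinuousOn ψ (Ioo a b)
  iInf_pos : 0 < ⨅ p ∈ Ioo a b, ψ p

/-- The Grand Lebesgue norm `‖g‖_{G(ψ)} = sup_{p ∈ supp ψ} |g|_p / ψ(p)` with respect to the
measure `μ`, where `supp ψ = {p | ψ p < ∞}`, as a value in `[0, ∞]`. -/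
noncomputable def glsNorm {X F : Type*} [MeasurableSpace X] [NormedAddCommGroup F]
    (μ : Measure X) (ψ : ℝ≥0∞ → ℝ≥0∞) (g : X → F) : ℝ≥0∞ :=
  ⨆ p ∈ {p | ψ p < ∞}, eLpNorm g p μ / ψ p

/-- The fundamental function `φ(G(ψ), δ) = sup_{p ∈ supp ψ} δ^{1/p} / ψ(p)`. By
`glsNorm_indicator` it is the `G(ψ)`-norm of the indicator of any set of measure `δ`. -/
noncomputable def glsFundamental (ψ : ℝ≥0∞ → ℝ≥0∞) (δ : ℝ≥0∞) : ℝ≥0∞ :=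
  ⨆ p ∈ {p | ψ p < ∞}, δ ^ (p⁻¹).toReal / ψ p

theorem glsNorm_indicator {X : Type*} [MeasurableSpace X] (μ : Measure X) {a b : ℝ≥0∞}
    {ψ : ℝ≥0∞ → ℝ≥0∞} (hψ : IsPsiFunction a b ψ) {S : Set X} (hS : MeasurableSet S) :
    glsNorm μ ψ (S.indicator fun _ => (1 : ℝ)) = glsFundamental ψ (μ S) := by
  unfold glsNorm glsFundamental
  refine iSup_congr fun p => iSup_congr fun hp => ?_
  rw [hψ.supp_eq] at hp
  have h0 : p ≠ 0 := (zero_le.trans_lt hp.1).ne'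
  have h1 : p ≠ ∞ := (hp.2.trans_le le_top).ne
  rw [eLpNorm_indicator_const hS h0 h1]
  simp

/-- `(A, u)` solves the Lusin problem `Du = f` on `Ω` up to proportion `ε`: `A ⊆ Ω` is open with
`|A| ≤ ε |Ω|`, `u` is a `C¹` function with compact support in `Ω`, and `Du = f` on `Ω \ A`. -/
structure IsLusinPair {d : ℕ} (Ω : Set (EuclideanSpace ℝ (Fin d)))
    (f : EuclideanSpace ℝ (Fin d) → EuclideanSpace ℝ (Fin d)) (ε : ℝ)
    (A : Set (EuclideanSpace ℝ (Fin d))) (u : EuclideanSpace ℝ (Fin d) → ℝ) : Prop where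
  isOpen : IsOpen A
  subset : A ⊆ Ω
  volume_le : volume A ≤ ENNReal.ofReal ε * volume Ω
  contDiff : ContDiff ℝ 1 u
  hasCompactSupport : HasCompactSupport u
  tsupport_subset : tsupport u ⊆ Ω
  gradient_eq : ∀ x ∈ Ω \ A, gradient u x = f x

/-- The estimate `|Du|_p ≤ K ε^{1/p - 1} |f|_p` in `L_p(Ω)` (for `p = ∞`, `1/p = 0`). -/
def LusinLpBound {d : ℕ} (K : ℝ≥0∞) (Ω : Set (EuclideanSpace ℝ (Fin d)))
    (f : EuclideanSpace ℝ (Fin d) → EuclideanSpace ℝ (Fin d)) (ε : ℝ)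
    (u : EuclideanSpace ℝ (Fin d) → ℝ) (p : ℝ≥0∞) : Prop :=
  eLpNorm (gradient u) p (volume.restrict Ω) ≤
    K * ENNReal.ofReal ε ^ ((p⁻¹).toReal - 1) * eLpNorm f p (volume.restrict Ω)

/-- The minimal constant `K(d)`, depending on the dimension only, for which all Lusin problems
(with `Ω` open of finite measure, `f` Borel on `Ω`, `ε > 0`) have solutions obeying the `L_p`
estimates for all `p ∈ [1, ∞]` at once. -/
noncomputable def lusinConst (d : ℕ) : ℝ≥0∞ :=
  sInf {K : ℝ≥0∞ | ∀ (Ω : Set (EuclideanSpace ℝ (Fin d)))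
    (f : EuclideanSpace ℝ (Fin d) → EuclideanSpace ℝ (Fin d)) (ε : ℝ),
    IsOpen Ω → volume Ω < ∞ → Measurable (Ω.domRestrict f) → 0 < ε →
    ∃ A u, IsLusinPair Ω f ε A u ∧ ∀ p, 1 ≤ p → LusinLpBound K Ω f ε u p}

/-! ### Oscillating potentials for a constant field -/

section

/-! The optimal constant is 2 in every dimension.

Upper bound. A constant field `v` is the gradient of `⟨v, x⟩`, which is not small and cannot be cut
off cheaply. Compose it instead with a rapidly oscillating sawtooth of slope 1, except on strips of
proportion about ε/2, where the slope may drop to -(2/ε - 1) and makes the mean slope zero. The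
resulting function is tiny, so a cutoff adds almost nothing to its gradient. The norm of this
gradient has mean about (2 - ε)|v| and supremum about (2/ε - 1)|v|, and g^p ≤ (sup g)^(p-1) g
interpolates to 2 ε^(1/p-1)|v| for all p with one and the same function, leaving slack of order ε
(`exists_laminate_piece`, `lintegral_two_valued_rpow_le`).

A general field is almost constant on finitely many compact pieces, which gives an approximate
solution (`exists_approximate_potential`). Its residual is uniformly small, and solving repeatedly
for residuals gives an exact solution in which all corrections together have gradient at most δ
(`exists_exact_potential`). The slack absorbs δ (`exists_isLusinPair_bound_two`).

Lower bound. As ∫ Du = 0, a unit constant field on a set of measure 1 forces |Du|_1 ≥ 2(1 - ε)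
(`IsLusinPair.two_mul_le_eLpNorm_one`). Taking ψ = 1, ζ(p) = ε^(1/p) and p → 1 turns this into a
Grand Lebesgue lower bound. Conversely, L_p bounds pass to Grand Lebesgue norms exponent by exponent
(`glsNorm_gradient_le`), so both kinds of estimate have the same best constant. -/

/-- A bounded `C¹` sawtooth on the line whose slope is `1` except on short `1`-periodic intervals. -/
theorem exists_periodic_sawtooth {ε : ℝ} (h0 : 0 < ε) (h1 : ε < 1) :
    ∃ S : ℝ → ℝ, ContDiff ℝ 1 S ∧ (∃ C, 0 < C ∧ ∀ y, |S y| ≤ C) ∧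
      (∀ y, |deriv S y| ≤ 2 / ε - 1) ∧
      ∀ y : ℝ, ε / 4 * (1 + ε / 4) ≤ ‖(y : UnitAddCircle)‖ → deriv S y = 1 := by
  set r := ε / 4 with hr
  set r' := ε / 4 * (1 + ε / 4) with hr'
  have hrr : 0 < r' - r := by rw [hr', hr]; nlinarith
  let ρ : ℝ → ℝ := fun y => max 0 (min 1 ((r' - ‖(y : UnitAddCircle)‖) / (r' - r)))
  have hρc : Continuous ρ := by
    have : Continuous fun y : ℝ => (y : UnitAddCircle) := AddCircle.continuous_mk' 1
    fun_prop
  have hρ0 : ∀ y, 0 ≤ ρ y := fun y => le_max_left _ _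
  have hρ1 : ∀ y, ρ y ≤ 1 := fun y => max_le zero_le_one (min_le_left _ _)
  have hρr : ∀ y : ℝ, |y| ≤ r → ρ y = 1 := by
    intro y hy
    have : ‖(y : UnitAddCircle)‖ ≤ r := QuotientAddGroup.norm_mk_le_norm.trans hy
    have h2 : 1 ≤ (r' - ‖(y : UnitAddCircle)‖) / (r' - r) := by
      rw [one_le_div hrr]; linarith
    simp [ρ, h2]
  have hρz : ∀ y : ℝ, r' ≤ ‖(y : UnitAddCircle)‖ → ρ y = 0 := by
    intro y hy
    have h2 : (r' - ‖(y : UnitAddCircle)‖) / (r' - r) ≤ 0 :=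
      div_nonpos_of_nonpos_of_nonneg (by linarith) hrr.le
    exact max_eq_left ((min_le_right _ _).trans h2)
  have hρp : Function.Periodic ρ 1 := by
    intro y
    simp [ρ]
  have hint : ∀ a b, IntervalIntegrable ρ volume a b := fun a b => hρc.intervalIntegrable a b
  set I := ∫ y in (-(1 / 2 : ℝ))..(-(1 / 2) + 1), ρ y with hI
  have hIle : ε / 2 ≤ I := by
    have h2 : ∫ y in (-r)..r, ρ y = ε / 2 := by
      rw [intervalIntegral.integral_congr (g := fun _ => (1 : ℝ))]
      · rw [intervalIntegral.integral_const, hr]; simp; ring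
      · intro y hy
        rw [uIcc_of_le (by rw [hr]; linarith)] at hy
        exact hρr y (abs_le.2 hy)
    rw [← h2, hI]
    exact intervalIntegral.integral_mono_interval (by linarith) (by linarith) (by linarith)
      (Filter.Eventually.of_forall hρ0) (hint _ _)
  have hI0 : 0 < I := by linarith
  -- Normalising the bump by its integral `I` gives the slope `q` mean zero over a period, so its
  -- primitive is periodic and hence bounded. The lower bound ε/2 for `I` gives q ≥ 1 - 2/ε.
  let q : ℝ → ℝ := fun y => 1 - ρ y / I
  have hqc : Continuous q := by fun_prop
  have hqint : ∀ a b, IntervalIntegrable q volume a b := fun a b => hqc.intervalIntegrable a b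
  have hd : ∀ y, HasDerivAt (fun y => ∫ t in (0 : ℝ)..y, q t) (q y) y := fun y =>
    intervalIntegral.integral_hasDerivAt_right (hqint _ _)
      (hqc.stronglyMeasurableAtFilter _ _) hqc.continuousAt
  have hderiv : deriv (fun y => ∫ t in (0 : ℝ)..y, q t) = q := funext fun y => (hd y).deriv
  have hper : Function.Periodic (fun y => ∫ t in (0 : ℝ)..y, q t) 1 := by
    intro y
    have hqp : Function.Periodic q 1 := fun y => by simp [q, hρp y]
    have e1 : ∫ t in y..(y + 1), q t = 0 := by
      rw [hqp.intervalIntegral_add_eq y (-(1 / 2))]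
      simp only [q]
      rw [intervalIntegral.integral_sub (by simp) ((hint _ _).div_const _),
        intervalIntegral.integral_div, ← hI, div_self hI0.ne']
      simp
    have e2 := intervalIntegral.integral_add_adjacent_intervals (hqint 0 y) (hqint y (y + 1))
    simp only
    rw [← e2, e1, add_zero]
  have hcd : ContDiff ℝ 1 (fun y => ∫ t in (0 : ℝ)..y, q t) := by
    rw [contDiff_one_iff_deriv, hderiv]
    exact ⟨fun y => (hd y).differentiableAt, hqc⟩
  refine ⟨_, hcd, ?_, ?_, ?_⟩
  · obtain ⟨C, hC0, hC⟩ :=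
      (hper.isBounded_of_continuous one_ne_zero hcd.continuous).exists_pos_norm_le
    exact ⟨C, hC0, fun y => hC _ (mem_range_self y)⟩
  · intro y
    rw [hderiv]
    have h2 : ρ y / I ≤ 2 / ε := by
      rw [div_le_div_iff₀ hI0 h0]; nlinarith [hρ1 y, hρ0 y]
    have h3 : 0 ≤ ρ y / I := div_nonneg (hρ0 y) hI0.le
    have h4 : 2 ≤ 2 / ε := by rw [le_div_iff₀ h0]; linarith
    simp only [q]
    rw [abs_le]; constructor <;> linarith
  · intro y hy
    rw [hderiv]
    simp [q, hρz y hy]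

/-- Among all shifts of the periodic strips of half-width `r`, some shift meets `U` in at most the
expected measure. -/
theorem exists_shift_measure_strip_le {X : Type*} [MeasurableSpace X] (μ : Measure X) {U : Set X}
    (hfin : μ U ≠ ∞) {g : X → ℝ} (hg : Measurable g) (r : ℝ) :
    ∃ t : ℝ, μ {x ∈ U | ‖((g x + t : ℝ) : UnitAddCircle)‖ < r} ≤ ENNReal.ofReal (2 * r) * μ U := by
  have : IsFiniteMeasure (μ.restrict U) := ⟨by simpa using hfin.lt_top⟩
  -- The shift is averaged over the circle, a probability space. For fixed `x` the bad shifts lie in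
  -- a ball of radius `r`, so Tonelli bounds the mean measure and some shift does at least as well.
  let B : Set (X × UnitAddCircle) := {z | ‖(g z.1 : UnitAddCircle) + z.2‖ < r}
  have hB : MeasurableSet B := by
    apply measurableSet_lt _ measurable_const
    have h1 : Measurable fun y : ℝ => (y : UnitAddCircle) := (AddCircle.continuous_mk' 1).measurable
    fun_prop
  have hsec : ∀ x, volume (Prod.mk x ⁻¹' B) ≤ ENNReal.ofReal (2 * r) := by
    intro x
    calc volume (Prod.mk x ⁻¹' B)
        ≤ volume (Metric.closedBall (-(g x : UnitAddCircle)) r) := by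
          apply measure_mono
          intro t ht
          simp only [B, mem_preimage, mem_ofPred_eq] at ht
          rw [Metric.mem_closedBall, dist_eq_norm, sub_neg_eq_add, add_comm]
          exact ht.le
      _ ≤ _ := by
          rw [AddCircle.volume_closedBall]
          exact ENNReal.ofReal_le_ofReal (min_le_right _ _)
  have htot : ((μ.restrict U).prod (volume : Measure UnitAddCircle)) B ≤
      ENNReal.ofReal (2 * r) * μ U := by
    rw [Measure.prod_apply hB]
    refine (lintegral_mono hsec).trans ?_
    simp
  rw [Measure.prod_apply_symm hB] at htot
  have : IsProbabilityMeasure (volume : Measure UnitAddCircle) := ⟨UnitAddCircle.measure_univ⟩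
  obtain ⟨t, ht⟩ := exists_le_lintegral (μ := (volume : Measure UnitAddCircle))
    (measurable_measure_prodMk_right (μ := μ.restrict U) hB).aemeasurable
  obtain ⟨t, rfl⟩ := QuotientAddGroup.mk_surjective t
  refine ⟨t, le_trans (le_of_eq ?_) (ht.trans htot)⟩
  rw [Measure.restrict_apply (measurable_prodMk_right hB)]
  congr 1
  ext x
  simp [B, and_comm]

variable {E : Type*} [NormedAddCommGroup E] [InnerProductSpace ℝ E] [FiniteDimensional ℝ E]

/-- A smooth cutoff between a compact set and an open neighbourhood. -/
theorem exists_contDiff_cutoff {K U : Set E} (hK : IsCompact K) (hU : IsOpen U) (hKU : K ⊆ U) :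
    ∃ φ : E → ℝ, ContDiff ℝ 1 φ ∧ HasCompactSupport φ ∧ tsupport φ ⊆ U ∧
      (∀ x, 0 ≤ φ x ∧ φ x ≤ 1) ∧ ∀ x ∈ K, φ x = 1 := by
  obtain ⟨V, hVo, hKV, hVU, hVc⟩ := exists_open_between_and_isCompact_closure hK hU hKU
  obtain ⟨φ, hφ, hr, hs, h1⟩ := exists_contMDiff_support_eq_eq_one_iff
    (modelWithCornersSelf ℝ E) (n := 1) hVo hK.isClosed hKV
  refine ⟨φ, hφ.contDiff, ?_, ?_, fun x => hr (mem_range_self x), fun x hx => (h1 x).1 hx⟩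
  · rw [HasCompactSupport, tsupport, hs]; exact hVc
  · rw [tsupport, hs]; exact hVU

theorem gradient_of_notMem_tsupport {u : E → ℝ} {x : E} (hx : x ∉ tsupport u) :
    gradient u x = 0 := by
  rw [gradient, fderiv_of_notMem_tsupport (𝕜 := ℝ) hx, map_zero]

/-- The function is φ(x) · h S(⟨v, x⟩/h + t), with gradient φ S' v + h S ∇φ. Small `h` makes the
second term negligible, and the shift `t` is chosen so that the strips where S' may differ from 1
take up at most their expected share of `U`. -/
theorem exists_laminate_piece [MeasurableSpace E] [BorelSpace E] (μ : Measure E) {ε δ : ℝ}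
    (h0 : 0 < ε) (h1 : ε < 1) (hδ : 0 < δ)
    {K U : Set E} (hK : IsCompact K) (hU : IsOpen U) (hKU : K ⊆ U) (hfin : μ U ≠ ∞) (v : E) :
    ∃ (u : E → ℝ) (B : Set E), ContDiff ℝ 1 u ∧ HasCompactSupport u ∧ tsupport u ⊆ U ∧
      IsOpen B ∧ B ⊆ U ∧ μ B ≤ ENNReal.ofReal (ε / 2 * (1 + ε / 4)) * μ U ∧
      (∀ x, |u x| ≤ δ) ∧ (∀ x ∈ B, ‖gradient u x‖ ≤ δ + (2 / ε - 1) * ‖v‖) ∧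
      (∀ x ∉ B, ‖gradient u x‖ ≤ δ + ‖v‖) ∧ ∀ x ∈ K \ B, ‖gradient u x - v‖ ≤ δ := by
  obtain ⟨S, hS, ⟨C, hC0, hC⟩, hS', hS1⟩ := exists_periodic_sawtooth h0 h1
  obtain ⟨φ, hφ, hφc, hφU, hφ01, hφ1⟩ := exists_contDiff_cutoff hK hU hKU
  have hφ'c : Continuous (fderiv ℝ φ) := hφ.continuous_fderiv one_ne_zero
  obtain ⟨D, hD0, hD⟩ : ∃ D, 0 < D ∧ ∀ x, ‖gradient φ x‖ ≤ D := by
    obtain ⟨D, hD⟩ := (hφc.fderiv (𝕜 := ℝ)).exists_bound_of_continuous hφ'c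
    refine ⟨max D 1, by positivity, fun x => ?_⟩
    rw [gradient, LinearIsometryEquiv.norm_map]
    exact (hD x).trans (le_max_left _ _)
  -- One choice makes both hC (bounding the function) and hCD (bounding the cutoff term) at most δ.
  set h := δ / (C * (1 + D)) with hh
  have hh0 : 0 < h := by positivity
  have hhC : h * C * (1 + D) = δ := by rw [hh]; field_simp
  let a : E → ℝ := fun x => h⁻¹ * inner ℝ v x
  have hac : Continuous a := by fun_prop
  obtain ⟨t, ht⟩ := exists_shift_measure_strip_le μ hfin hac.measurable
    (ε / 4 * (1 + ε / 4))
  let s : E → ℝ := fun x => h * S (a x + t)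
  have hs : ∀ x, |s x| ≤ h * C := fun x => by
    rw [abs_mul, abs_of_pos hh0]
    exact mul_le_mul_of_nonneg_left (hC _) hh0.le
  have hsd : ∀ x, HasGradientAt s (deriv S (a x + t) • v) x := by
    intro x
    have e1 : HasFDerivAt (fun x => a x + t) (h⁻¹ • innerSL ℝ v) x :=
      (((innerSL ℝ v).hasFDerivAt).const_mul h⁻¹).add_const t
    have e2 : HasDerivAt S (deriv S (a x + t)) (a x + t) :=
      ((hS.differentiable one_ne_zero) _).hasDerivAt
    have e3 := (e2.comp_hasFDerivAt x e1).const_mul h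
    rw [hasGradientAt_iff_hasFDerivAt]
    have e4 : InnerProductSpace.toDual ℝ E (deriv S (a x + t) • v) =
        h • deriv S (a x + t) • h⁻¹ • innerSL ℝ v := by
      ext y
      simp
      field_simp
    rw [e4]
    exact e3
  have hg : ∀ x, gradient (fun x => φ x * s x) x =
      (φ x * deriv S (a x + t)) • v + s x • gradient φ x := by
    intro x
    apply HasGradientAt.gradient
    have e1 := ((hφ.differentiable one_ne_zero) x).hasGradientAt
    have e2 := hsd x
    rw [hasGradientAt_iff_hasFDerivAt] at e1 e2 ⊢
    rw [map_add, map_smul, map_smul, mul_smul, ← map_smul (InnerProductSpace.toDual ℝ E)]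
    exact e1.mul e2
  have hsupp : tsupport (fun x => φ x * s x) ⊆ tsupport φ := tsupport_mul_subset_left
  have hcont : ContDiff ℝ 1 fun x => a x + t :=
    (contDiff_const.mul (contDiff_const.inner ℝ contDiff_id)).add contDiff_const
  have hsm : ∀ x, ‖s x • gradient φ x‖ ≤ δ := by
    intro x
    rw [norm_smul, Real.norm_eq_abs]
    calc |s x| * ‖gradient φ x‖ ≤ h * C * D :=
          mul_le_mul (hs x) (hD x) (norm_nonneg _) (by positivity)
      _ ≤ δ := by nlinarith [mul_pos hh0 hC0]
  have hbound : ∀ x c, |deriv S (a x + t)| ≤ c → ‖gradient (fun x => φ x * s x) x‖ ≤ δ + c * ‖v‖ := by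
    intro x c hc
    rw [hg, add_comm]
    refine (norm_add_le _ _).trans (add_le_add (hsm x) ?_)
    rw [norm_smul, Real.norm_eq_abs, abs_mul, abs_of_nonneg (hφ01 x).1]
    refine mul_le_mul_of_nonneg_right ?_ (norm_nonneg _)
    nlinarith [(hφ01 x).2, abs_nonneg (deriv S (a x + t)), (hφ01 x).1]
  refine ⟨fun x => φ x * s x, {x ∈ U | ‖((a x + t : ℝ) : UnitAddCircle)‖ < ε / 4 * (1 + ε / 4)},
    ?_, ?_, ?_, ?_, ?_, ?_, ?_, ?_, ?_, ?_⟩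
  · refine hφ.mul (contDiff_const.mul (hS.comp hcont))
  · exact hφc.mul_right
  · exact hsupp.trans hφU
  · refine hU.inter (t := {x | ‖((a x + t : ℝ) : UnitAddCircle)‖ < _}) (isOpen_lt ?_ continuous_const)
    have : Continuous fun y : ℝ => (y : UnitAddCircle) := AddCircle.continuous_mk' 1
    exact (this.comp hcont.continuous).norm
  · exact fun x hx => hx.1
  · convert ht using 3
    ring
  · intro x
    rw [abs_mul, abs_of_nonneg (hφ01 x).1]
    have := hs x
    have h3 : 0 < h * C * D := by positivity
    nlinarith [(hφ01 x).2, abs_nonneg (s x), (hφ01 x).1]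
  · intro x _
    exact hbound x _ (hS' _)
  · intro x hx
    by_cases hxU : x ∈ U
    · have := hS1 (a x + t) (not_lt.1 fun hlt => hx ⟨hxU, hlt⟩)
      simpa using hbound x 1 (by rw [this, abs_one])
    · rw [gradient_of_notMem_tsupport fun hx' => hxU (hφU (hsupp hx')), norm_zero]
      positivity
  · rintro x ⟨hxK, hxB⟩
    have := hS1 (a x + t) (not_lt.1 fun hlt => hxB ⟨hKU hxK, hlt⟩)
    rw [hg, this, hφ1 x hxK]
    simpa using hsm x

end

/-! ### Decomposition into pieces where the field is almost constant -/

section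

variable {E : Type*} [NormedAddCommGroup E] [InnerProductSpace ℝ E] [FiniteDimensional ℝ E]

/-- Pairwise disjoint compact sets have pairwise disjoint open neighbourhoods. -/
theorem exists_pairwise_disjoint_open_nhds {X ι : Type*} [PseudoEMetricSpace X] [Finite ι]
    {K : ι → Set X} (hK : ∀ i, IsClosed (K i)) (hd : Pairwise (Function.onFun Disjoint K)) :
    ∃ U : ι → Set X, (∀ i, IsOpen (U i)) ∧ (∀ i, K i ⊆ U i) ∧
      Pairwise (Function.onFun Disjoint U) := by
  let R : ι → Set X := fun i => ⋃ j ∈ {j | j ≠ i}, K j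
  refine ⟨fun i => {x | Metric.infEDist x (K i) < Metric.infEDist x (R i)}, fun i => ?_,
    fun i x hx => ?_, fun i j hij => ?_⟩
  · exact isOpen_lt Metric.continuous_infEDist Metric.continuous_infEDist
  · have hR : IsClosed (R i) := (toFinite _).isClosed_biUnion fun j _ => hK j
    have hxR : x ∉ R i := by
      intro h
      simp only [R, mem_iUnion] at h
      obtain ⟨j, hj, hxj⟩ := h
      exact disjoint_left.1 (hd hj) hxj hx
    rw [mem_ofPred_eq, Metric.infEDist_zero_of_mem hx, pos_iff_ne_zero]
    exact fun h => hxR ((Metric.mem_iff_infEDist_zero_of_closed hR).2 h)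
  · rw [Function.onFun, disjoint_left]
    intro x hi hj
    have h1 : Metric.infEDist x (R i) ≤ Metric.infEDist x (K j) :=
      Metric.infEDist_anti (subset_biUnion_of_mem (u := K) (show j ∈ {j | j ≠ i} from hij.symm))
    have h2 : Metric.infEDist x (R j) ≤ Metric.infEDist x (K i) :=
      Metric.infEDist_anti (subset_biUnion_of_mem (u := K) (show i ∈ {i | i ≠ j} from hij))
    exact lt_irrefl _ ((hi.trans_le h1).trans (hj.trans_le h2))

/-- Up to small measure, a measurable function on an open set of finite measure is close to a
constant on each of finitely many compact sets, which have disjoint open neighbourhoods of almost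
the same measure. -/
theorem exists_almost_constant_pieces {F : Type*} [NormedAddCommGroup F]
    [SecondCountableTopology F] [MeasurableSpace F] [BorelSpace F] [MeasurableSpace E]
    [BorelSpace E] (μ : Measure E) [IsLocallyFiniteMeasure μ] {Ω : Set E} (hΩ : IsOpen Ω)
    (hfin : μ Ω ≠ ∞) {f : E → F} (hf : Measurable f) {δ : ℝ} (hδ : 0 < δ) {τ η : ℝ≥0∞}
    (hτ : τ ≠ 0) (hη : η ≠ 0) :
    ∃ (N : ℕ) (K U : Fin N → Set E) (v : Fin N → F), (∀ n, IsCompact (K n)) ∧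
      (∀ n, IsOpen (U n)) ∧ (∀ n, K n ⊆ U n) ∧ (∀ n, U n ⊆ Ω) ∧
      Pairwise (Function.onFun Disjoint U) ∧ (∀ n, μ (U n) ≤ (1 + τ) * μ (K n)) ∧
      (∀ n, μ (K n) = 0 → U n = ∅) ∧ (∀ n, ∀ x ∈ K n, ‖f x - v n‖ ≤ δ) ∧
      μ (Ω \ ⋃ n, K n) ≤ η := by
  let S : ℕ → Set E := fun n => f ⁻¹' Metric.ball (TopologicalSpace.denseSeq F n) δ
  let T : ℕ → Set E := fun n => Ω ∩ disjointed S n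
  have hTm : ∀ n, MeasurableSet (T n) := fun n =>
    hΩ.measurableSet.inter (MeasurableSet.disjointed (fun n => hf Metric.isOpen_ball.measurableSet) n)
  have hTfin : ∀ n, μ (T n) ≠ ∞ := fun n => measure_ne_top_of_subset inter_subset_left hfin
  have hTd : Pairwise (Function.onFun Disjoint T) := fun i j hij =>
    (disjoint_disjointed S hij).mono inter_subset_right inter_subset_right
  have hTU : ⋃ n, T n = Ω := by
    have hS : ⋃ n, S n = univ := by
      refine eq_univ_of_forall fun x => ?_
      obtain ⟨n, hn⟩ := (TopologicalSpace.denseRange_denseSeq F).exists_dist_lt (f x) hδ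
      exact mem_iUnion.2 ⟨n, hn⟩
    rw [← inter_iUnion, iUnion_disjointed, hS, inter_univ]
  have hη2 : 0 < η / 2 := ENNReal.half_pos hη
  obtain ⟨N, hN⟩ : ∃ N : ℕ, μ (Ω \ ⋃ n : Fin N, T n) < η / 2 := by
    have ht : Filter.Tendsto (fun N : ℕ => μ (Ω \ ⋃ n : Fin N, T n)) Filter.atTop
        (nhds (μ (⋂ N : ℕ, (Ω \ ⋃ n : Fin N, T n)))) := by
      apply tendsto_measure_iInter_atTop
      · exact fun N => (hΩ.measurableSet.diff (MeasurableSet.iUnion fun n : Fin N => hTm n)).nullMeasurableSet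
      · intro a b hab
        refine sdiff_subset_sdiff_right (iUnion_subset fun n => ?_)
        exact subset_iUnion (fun n : Fin b => T n) (Fin.castLE hab n)
      · exact ⟨0, measure_ne_top_of_subset sdiff_subset hfin⟩
    have he : ⋂ N : ℕ, (Ω \ ⋃ n : Fin N, T n) = ∅ := by
      refine eq_empty_of_forall_notMem fun x hx => ?_
      rw [mem_iInter] at hx
      have hxΩ := (hx 0).1
      rw [← hTU, mem_iUnion] at hxΩ
      obtain ⟨n, hn⟩ := hxΩ
      exact (hx (n + 1)).2 (mem_iUnion.2 ⟨Fin.last n, hn⟩)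
    rw [he, measure_empty] at ht
    exact ((tendsto_order.1 ht).2 _ hη2).exists
  -- If `N = 0` the quotient is `∞`, which is harmless: there are then no pieces.
  have hρ : η / 2 / N ≠ 0 := (ENNReal.div_pos hη2.ne' (ENNReal.natCast_ne_top N)).ne'
  choose C hCT hCc hCm using fun n : Fin N => (hTm n).exists_isCompact_sdiff_lt (hTfin n) hρ
  classical
  -- Null pieces are emptied. Outer regularity with factor 1 + τ needs positive measure, and a
  -- neighbourhood of a null piece would carry a value `v n` not controlled by the essential
  -- supremum of `f`.
  let K : Fin N → Set E := fun n => if μ (C n) = 0 then ∅ else C n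
  have hKC : ∀ n, K n ⊆ C n := fun n => by
    simp only [K]; split_ifs
    · exact empty_subset _
    · exact Subset.rfl
  have hKc : ∀ n, IsCompact (K n) := fun n => by
    simp only [K]; split_ifs
    · exact isCompact_empty
    · exact hCc n
  have hK0 : ∀ n, μ (K n) = 0 → K n = ∅ := fun n => by
    simp only [K]; split_ifs with h
    · exact fun _ => rfl
    · exact fun h' => absurd h' h
  have hKm : ∀ n : Fin N, μ (T n \ K n) ≤ η / 2 / N := fun n => by
    simp only [K]; split_ifs with h
    · rw [sdiff_empty]
      calc μ (T n) ≤ μ (T n \ C n) + μ (C n) := by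
            exact (measure_mono (by intro x hx; by_cases hxc : x ∈ C n <;> simp [hx, hxc])).trans
              (measure_union_le _ _)
        _ ≤ _ := by rw [h, add_zero]; exact (hCm n).le
    · exact (hCm n).le
  have hKd : Pairwise (Function.onFun Disjoint K) := fun i j hij =>
    (hTd (fun h => hij (Fin.ext h))).mono ((hKC i).trans (hCT i)) ((hKC j).trans (hCT j))
  obtain ⟨W, hWo, hKW, hWd⟩ := exists_pairwise_disjoint_open_nhds (fun n => (hKc n).isClosed) hKd
  have hV : ∀ n, ∃ V, IsOpen V ∧ K n ⊆ V ∧ μ V ≤ (1 + τ) * μ (K n) ∧ (μ (K n) = 0 → V = ∅) := by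
    intro n
    by_cases h : μ (K n) = 0
    · exact ⟨∅, isOpen_empty, (hK0 n h).le, by simp, fun _ => rfl⟩
    · have hlt : μ (K n) < (1 + τ) * μ (K n) := by
        rw [add_mul, one_mul]
        exact ENNReal.lt_add_right (hKc n).measure_lt_top.ne (mul_ne_zero hτ h)
      obtain ⟨V, hKV, hVo, hVm⟩ := (K n).exists_isOpen_lt_of_lt _ hlt
      exact ⟨V, hVo, hKV, hVm.le, fun h' => absurd h' h⟩
  choose V hVo hKV hVm hV0 using hV
  refine ⟨N, K, fun n => V n ∩ W n ∩ Ω, fun n => TopologicalSpace.denseSeq F n, hKc,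
    fun n => ((hVo n).inter (hWo n)).inter hΩ,
    fun n x hx => ⟨⟨hKV n hx, hKW n hx⟩, (hCT n (hKC n hx)).1⟩, fun n => inter_subset_right,
    fun i j hij => (hWd hij).mono (fun x hx => hx.1.2) (fun x hx => hx.1.2),
    fun n => (measure_mono fun x hx => hx.1.1).trans (hVm n),
    fun n h => ?_, fun n x hx => ?_, ?_⟩
  · simp only [hV0 n h, empty_inter, empty_inter]
  · have := disjointed_subset S n (hCT n (hKC n hx)).2
    rw [← dist_eq_norm]
    exact (Metric.mem_ball.1 this).le
  · have hsub : Ω \ ⋃ n, K n ⊆ (Ω \ ⋃ n : Fin N, T n) ∪ ⋃ n : Fin N, (T n \ K n) := by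
      rintro x ⟨hx, hxK⟩
      by_cases hxT : x ∈ ⋃ n : Fin N, T n
      · obtain ⟨n, hn⟩ := mem_iUnion.1 hxT
        exact Or.inr (mem_iUnion.2 ⟨n, hn, fun h => hxK (mem_iUnion.2 ⟨n, h⟩)⟩)
      · exact Or.inl ⟨hx, hxT⟩
    calc μ (Ω \ ⋃ n, K n) ≤ μ (Ω \ ⋃ n : Fin N, T n) + μ (⋃ n : Fin N, (T n \ K n)) :=
          (measure_mono hsub).trans (measure_union_le _ _)
      _ ≤ η / 2 + ∑ n : Fin N, η / 2 / N :=
          add_le_add hN.le ((measure_iUnion_fintype_le _ _).trans (Finset.sum_le_sum fun n _ => hKm n))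
      _ ≤ η / 2 + η / 2 := by
          gcongr
          rw [Finset.sum_const, Finset.card_univ, Fintype.card_fin, nsmul_eq_mul]
          exact ENNReal.mul_div_le
      _ = η := ENNReal.add_halves η

end

/-! ### The sharp `L_p` estimate, gluing, and uniform control of errors -/

section

variable {E : Type*} [NormedAddCommGroup E] [InnerProductSpace ℝ E] [FiniteDimensional ℝ E]

/-- The integrand is g w raised to `p`, with g = 2/ε - 1 on `B` and 1 elsewhere. Interpolate between
`L_1` and `L_∞` by g^p ≤ L^(p-1) g: both the mean of g and εL are bounded by 2(1 - ε/4). -/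
theorem lintegral_two_valued_rpow_le {X : Type*} [MeasurableSpace X] (μ : Measure X) {ε : ℝ}
    (h0 : 0 < ε) (h1 : ε < 1) {U B : Set X} (hB : MeasurableSet B) {m : ℝ≥0∞}
    (hBm : μ B ≤ ENNReal.ofReal (ε / 2 * (1 + ε / 4)) * μ U)
    (hUm : μ U ≤ (1 + ENNReal.ofReal (ε / 8)) * m) {p : ℝ} (hp : 1 ≤ p) (w : ℝ≥0∞) :
    ∫⁻ x in U, (B.indicator (fun _ => ENNReal.ofReal (2 / ε - 2) * w) x + w) ^ p ∂μ ≤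
      ENNReal.ofReal (2 * (1 - ε / 4)) ^ p * ENNReal.ofReal ε ^ (1 - p) * (w ^ p * m) := by
  have hε : 0 < 2 / ε - 2 := by
    have : 2 < 2 / ε := by rw [lt_div_iff₀ h0]; linarith
    linarith
  set L := ENNReal.ofReal (2 / ε - 1) with hL
  set c := ENNReal.ofReal (2 / ε - 2) with hc
  have hcL : c + 1 = L := by
    rw [hc, hL, ← ENNReal.ofReal_one, ← ENNReal.ofReal_add hε.le zero_le_one]
    congr 1; ring
  have hL1 : 1 ≤ L := by rw [← hcL]; exact le_add_self
  have hLt : L ≠ ∞ := ENNReal.ofReal_ne_top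
  have hpt : ∀ x, (B.indicator (fun _ => c * w) x + w) ^ p ≤
      (L ^ (p - 1) * w ^ p) * (B.indicator (fun _ => c) x + 1) := by
    intro x
    have e1 : B.indicator (fun _ => c * w) x + w = (B.indicator (fun _ => c) x + 1) * w := by
      by_cases hx : x ∈ B <;> simp [hx, add_mul]
    have e2 : B.indicator (fun _ => c) x + 1 ≤ L := by
      by_cases hx : x ∈ B <;> simp [hx, hcL, hL1]
    have e3 : B.indicator (fun _ => c) x + 1 ≠ 0 := by simp
    have e4 : B.indicator (fun _ => c) x + 1 ≠ ∞ := ne_top_of_le_ne_top hLt e2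
    rw [e1, ENNReal.mul_rpow_of_nonneg _ _ (by linarith)]
    generalize B.indicator (fun _ => c) x + 1 = g at *
    calc g ^ p * w ^ p = g ^ (p - 1) * g * w ^ p := by
          congr 1
          nth_rewrite 3 [← ENNReal.rpow_one g]
          rw [← ENNReal.rpow_add _ _ e3 e4, sub_add_cancel]
      _ ≤ L ^ (p - 1) * g * w ^ p := by
          gcongr
      _ = _ := by ring
  -- Without the enlargements 1 + ε/4 and 1 + ε/8 the product would be 2 - ε; they cost at most ε/2
  -- together.
  have hnum : (1 + ENNReal.ofReal (2 / ε - 2) * ENNReal.ofReal (ε / 2 * (1 + ε / 4))) *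
      (1 + ENNReal.ofReal (ε / 8)) ≤ ENNReal.ofReal (2 * (1 - ε / 4)) := by
    rw [← ENNReal.ofReal_one, ← ENNReal.ofReal_mul hε.le,
      ← ENNReal.ofReal_add zero_le_one (by positivity),
      ← ENNReal.ofReal_add zero_le_one (by positivity), ← ENNReal.ofReal_mul (by positivity)]
    apply ENNReal.ofReal_le_ofReal
    have : (2 / ε - 2) * (ε / 2 * (1 + ε / 4)) = (1 - ε) * (1 + ε / 4) := by
      field_simp
    rw [this]
    nlinarith [mul_pos h0 h0, mul_pos (mul_pos h0 h0) h0]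
  have hLle : L ^ (p - 1) ≤
      ENNReal.ofReal (2 * (1 - ε / 4)) ^ (p - 1) * ENNReal.ofReal ε ^ (1 - p) := by
    have e1 : L ≤ ENNReal.ofReal (2 * (1 - ε / 4)) * (ENNReal.ofReal ε)⁻¹ := by
      rw [← ENNReal.ofReal_inv_of_pos h0, ← ENNReal.ofReal_mul (by linarith)]
      apply ENNReal.ofReal_le_ofReal
      have : 2 * (1 - ε / 4) * ε⁻¹ = 2 / ε - 1 / 2 := by
        field_simp
        norm_num
      rw [this]; linarith
    calc L ^ (p - 1) ≤ (ENNReal.ofReal (2 * (1 - ε / 4)) * (ENNReal.ofReal ε)⁻¹) ^ (p - 1) :=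
          ENNReal.rpow_le_rpow e1 (by linarith)
      _ = _ := by
          rw [ENNReal.mul_rpow_of_nonneg _ _ (by linarith), ENNReal.inv_rpow,
            ← ENNReal.rpow_neg, neg_sub]
  have hDp : ENNReal.ofReal (2 * (1 - ε / 4)) ^ (p - 1) * ENNReal.ofReal (2 * (1 - ε / 4)) =
      ENNReal.ofReal (2 * (1 - ε / 4)) ^ p := by
    have h3 : (ENNReal.ofReal (2 * (1 - ε / 4))) ≠ 0 := by
      rw [ne_eq, ENNReal.ofReal_eq_zero]; linarith
    nth_rewrite 2 [← ENNReal.rpow_one (ENNReal.ofReal (2 * (1 - ε / 4)))]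
    rw [← ENNReal.rpow_add _ _ h3 ENNReal.ofReal_ne_top, sub_add_cancel]
  calc ∫⁻ x in U, (B.indicator (fun _ => c * w) x + w) ^ p ∂μ
      ≤ ∫⁻ x in U, (L ^ (p - 1) * w ^ p) * (B.indicator (fun _ => c) x + 1) ∂μ := lintegral_mono hpt
    _ = (L ^ (p - 1) * w ^ p) * (c * μ (B ∩ U) + μ U) := by
        rw [lintegral_const_mul _ (by fun_prop (disch := assumption)),
          lintegral_add_right _ measurable_const,
          lintegral_indicator_const hB, Measure.restrict_apply hB]
        simp
    _ ≤ (L ^ (p - 1) * w ^ p) * (c * (ENNReal.ofReal (ε / 2 * (1 + ε / 4)) * μ U) + μ U) := by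
        gcongr
        exact (measure_mono inter_subset_left).trans hBm
    _ = (L ^ (p - 1) * w ^ p) * ((1 + c * ENNReal.ofReal (ε / 2 * (1 + ε / 4))) * μ U) := by ring
    _ ≤ (L ^ (p - 1) * w ^ p) * ((1 + c * ENNReal.ofReal (ε / 2 * (1 + ε / 4))) *
          ((1 + ENNReal.ofReal (ε / 8)) * m)) := by gcongr
    _ = L ^ (p - 1) * ((1 + c * ENNReal.ofReal (ε / 2 * (1 + ε / 4))) *
          (1 + ENNReal.ofReal (ε / 8))) * (w ^ p * m) := by ring
    _ ≤ (ENNReal.ofReal (2 * (1 - ε / 4)) ^ (p - 1) * ENNReal.ofReal ε ^ (1 - p)) *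
          ENNReal.ofReal (2 * (1 - ε / 4)) * (w ^ p * m) := by gcongr
    _ = _ := by rw [← hDp]; ring

/-- A finite sum of `C¹` functions supported in disjoint open sets coincides with each summand on
the corresponding set. -/
theorem glue_disjoint_supports {ι : Type*} [Fintype ι] {U : ι → Set E} (hU : ∀ i, IsOpen (U i))
    (hd : Pairwise (Function.onFun Disjoint U)) {u : ι → E → ℝ} (hu : ∀ i, ContDiff ℝ 1 (u i))
    (hc : ∀ i, HasCompactSupport (u i)) (hs : ∀ i, tsupport (u i) ⊆ U i) :
    ContDiff ℝ 1 (fun x => ∑ i, u i x) ∧ HasCompactSupport (fun x => ∑ i, u i x) ∧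
      tsupport (fun x => ∑ i, u i x) ⊆ ⋃ i, U i ∧
      ∀ i, ∀ x ∈ U i, ∑ j, u j x = u i x ∧
        gradient (fun x => ∑ j, u j x) x = gradient (u i) x := by
  have hsub : tsupport (fun x => ∑ i, u i x) ⊆ ⋃ i, tsupport (u i) := by
    refine closure_minimal ?_ (isClosed_iUnion_of_finite fun i => isClosed_tsupport (u i))
    intro x hx
    by_contra hx'
    simp only [mem_iUnion, not_exists] at hx'
    exact hx (Finset.sum_eq_zero fun i _ => image_eq_zero_of_notMem_tsupport (hx' i))
  have hval : ∀ i, ∀ x ∈ U i, ∑ j, u j x = u i x := by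
    intro i x hx
    refine Finset.sum_eq_single i (fun j _ hj => ?_) (by simp)
    exact image_eq_zero_of_notMem_tsupport fun h => disjoint_left.1 (hd hj) (hs j h) hx
  refine ⟨ContDiff.sum fun i _ => hu i, ?_, hsub.trans (iUnion_mono hs), fun i x hx =>
    ⟨hval i x hx, ?_⟩⟩
  · exact (isCompact_iUnion fun i => hc i).of_isClosed_subset (isClosed_tsupport _) hsub
  · have : (fun x => ∑ j, u j x) =ᶠ[nhds x] u i :=
      Filter.eventually_of_mem ((hU i).mem_nhds hx) (hval i)
    rw [gradient, this.fderiv_eq, gradient]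

/-- Lets additive errors be multiplied by the factor ε^(1/p-1) at no loss. -/
theorem one_le_rpow_inv_toReal_sub_one {ε : ℝ} (h0 : 0 < ε) (h1 : ε ≤ 1) {p : ℝ≥0∞}
    (hp : 1 ≤ p) : 1 ≤ ENNReal.ofReal ε ^ ((p⁻¹).toReal - 1) := by
  have h2 : (p⁻¹).toReal ≤ 1 := by
    rw [← ENNReal.toReal_one]
    exact ENNReal.toReal_mono ENNReal.one_ne_top (ENNReal.inv_le_one.2 hp)
  rcases eq_or_lt_of_le h2 with h | h
  · simp [h]
  · exact ENNReal.one_le_rpow_of_pos_of_le_one_of_neg (ENNReal.ofReal_pos.2 h0)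
      (ENNReal.ofReal_le_one.2 h1) (by linarith)

theorem rpow_inv_le_one_add (m : ℝ≥0∞) {s : ℝ} (h0 : 0 ≤ s) (h1 : s ≤ 1) : m ^ s ≤ 1 + m := by
  rcases le_total m 1 with h | h
  · exact (ENNReal.rpow_le_one h h0).trans le_self_add
  · calc m ^ s ≤ m ^ (1 : ℝ) := ENNReal.rpow_le_rpow_of_exponent_le h h1
      _ ≤ _ := by rw [ENNReal.rpow_one]; exact le_add_self

/-- Minkowski's inequality, with μ(X)^(1/p) replaced by 1 + μ(X): the error must not depend on `p`,
since one function has to serve all exponents. -/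
theorem eLpNorm_le_eLpNorm_add_const {X F : Type*} [MeasurableSpace X] [TopologicalSpace F]
    [ESeminormedAddMonoid F] {μ : Measure X} {g : X → F} {G : X → ℝ≥0∞} (hG : AEMeasurable G μ)
    (c : ℝ≥0∞) {p : ℝ≥0∞} (hp : 1 ≤ p) (h : ∀ᵐ x ∂μ, ‖g x‖ₑ ≤ G x + c) :
    eLpNorm g p μ ≤ eLpNorm G p μ + c * (1 + μ univ) := by
  calc eLpNorm g p μ ≤ eLpNorm (G + fun _ => c) p μ :=
        eLpNorm_mono_enorm_ae (h.mono fun x hx => by simpa using hx)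
    _ ≤ eLpNorm G p μ + eLpNorm (fun _ => c) p μ :=
        eLpNorm_add_le hG.aestronglyMeasurable aestronglyMeasurable_const hp
    _ ≤ _ := by
        gcongr
        rcases eq_or_ne μ 0 with h0 | h0
        · simp [h0]
        · rw [eLpNorm_const _ (zero_lt_one.trans_le hp).ne' h0, one_div, ← ENNReal.toReal_inv]
          simp only [enorm_eq_self]
          gcongr
          refine rpow_inv_le_one_add _ ENNReal.toReal_nonneg ?_
          rw [← ENNReal.toReal_one]
          exact ENNReal.toReal_mono ENNReal.one_ne_top (ENNReal.inv_le_one.2 hp)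

/-- The two-valued estimate has the same factor on every piece, so p-th powers can be summed, and |v
n|^p μ(K n) is at most the integral of (|f| + c)^p over `K n`. The p-th root turns D^p ε^(1-p) into
D ε^(1/p-1). -/
theorem eLpNorm_le_of_pieces {X F G : Type*} [MeasurableSpace X] [NormedAddCommGroup F]
    [NormedAddCommGroup G] [MeasurableSpace F] [BorelSpace F]
    (μ : Measure X) {ε : ℝ} (h0 : 0 < ε) (h1 : ε < 1) {Ω : Set X}
    {N : ℕ} {K U B : Fin N → Set X} (hK : ∀ n, MeasurableSet (K n)) (hU : ∀ n, MeasurableSet (U n))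
    (hB : ∀ n, MeasurableSet (B n)) (hKΩ : ∀ n, K n ⊆ Ω) (hUΩ : ∀ n, U n ⊆ Ω)
    (hKd : Pairwise (Function.onFun Disjoint K))
    (hBm : ∀ n, μ (B n) ≤ ENNReal.ofReal (ε / 2 * (1 + ε / 4)) * μ (U n))
    (hUm : ∀ n, μ (U n) ≤ (1 + ENNReal.ofReal (ε / 8)) * μ (K n))
    {f : X → F} (hf : Measurable f) {v : Fin N → F} {c : ℝ≥0∞}
    (hv : ∀ n, ∀ x ∈ K n, ‖v n‖ₑ ≤ ‖f x‖ₑ + c) {g : X → G}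
    (hin : ∀ n, ∀ x ∈ U n, ‖g x‖ₑ ≤
      ((B n).indicator (fun _ => ENNReal.ofReal (2 / ε - 2) * ‖v n‖ₑ) x + ‖v n‖ₑ) + c)
    (hout : ∀ x, x ∉ ⋃ n, U n → g x = 0) {p : ℝ≥0∞} (hp : 1 ≤ p) (hp' : p ≠ ∞) :
    eLpNorm g p (μ.restrict Ω) ≤ ENNReal.ofReal (2 * (1 - ε / 4)) *
      ENNReal.ofReal ε ^ ((p⁻¹).toReal - 1) *
        (eLpNorm f p (μ.restrict Ω) + c * (1 + μ Ω)) + c * (1 + μ Ω) := by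
  have hp0 : p ≠ 0 := (zero_lt_one.trans_le hp).ne'
  set q := p.toReal with hq
  have hq1 : 1 ≤ q := by
    rw [hq, ← ENNReal.toReal_one]; exact ENNReal.toReal_mono hp' hp
  have hq0 : 0 < q := by linarith
  set D := ENNReal.ofReal (2 * (1 - ε / 4))
  set e := ENNReal.ofReal ε with he
  have he0 : e ≠ 0 := (ENNReal.ofReal_pos.2 h0).ne'
  let b : Fin N → X → ℝ≥0∞ := fun n x =>
    (B n).indicator (fun _ => ENNReal.ofReal (2 / ε - 2) * ‖v n‖ₑ) x + ‖v n‖ₑ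
  have hb : ∀ n, Measurable (b n) := fun n =>
    (measurable_const.indicator (hB n)).add_const _
  let H : X → ℝ≥0∞ := fun x => ∑ n, (U n).indicator (fun x => b n x ^ q) x
  have hHn : ∀ n, Measurable ((U n).indicator (fun x => b n x ^ q)) := fun n =>
    ((hb n).pow_const q).indicator (hU n)
  have hH : Measurable H := Finset.measurable_fun_sum _ fun n _ => hHn n
  have hpt : ∀ x, ‖g x‖ₑ ≤ H x ^ q⁻¹ + c := by
    intro x
    by_cases hx : x ∈ ⋃ n, U n
    · obtain ⟨n, hn⟩ := mem_iUnion.1 hx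
      refine (hin n x hn).trans (add_le_add_left ?_ c)
      have h2 : b n x ^ q ≤ H x := by
        have := Finset.single_le_sum (f := fun n => (U n).indicator (fun x => b n x ^ q) x)
          (fun _ _ => zero_le) (Finset.mem_univ n)
        simpa [hn] using this
      calc b n x = (b n x ^ q) ^ q⁻¹ := by
            rw [← ENNReal.rpow_mul, mul_inv_cancel₀ hq0.ne', ENNReal.rpow_one]
        _ ≤ _ := ENNReal.rpow_le_rpow h2 (inv_nonneg.2 hq0.le)
    · simp [hout x hx]
  have hint : ∫⁻ x in Ω, H x ∂μ ≤ D ^ q * e ^ (1 - q) * ∫⁻ x in Ω, (‖f x‖ₑ + c) ^ q ∂μ := by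
    calc ∫⁻ x in Ω, H x ∂μ = ∑ n, ∫⁻ x in Ω, (U n).indicator (fun x => b n x ^ q) x ∂μ :=
          lintegral_finsetSum _ fun n _ => hHn n
      _ = ∑ n, ∫⁻ x in U n, b n x ^ q ∂μ := by
          refine Finset.sum_congr rfl fun n _ => ?_
          rw [lintegral_indicator (hU n), Measure.restrict_restrict (hU n),
            inter_eq_left.2 (hUΩ n)]
      _ ≤ ∑ n, D ^ q * e ^ (1 - q) * (‖v n‖ₑ ^ q * μ (K n)) :=
          Finset.sum_le_sum fun n _ =>
            lintegral_two_valued_rpow_le μ h0 h1 (hB n) (hBm n) (hUm n) hq1 _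
      _ = D ^ q * e ^ (1 - q) * ∑ n, ‖v n‖ₑ ^ q * μ (K n) := by rw [Finset.mul_sum]
      _ ≤ D ^ q * e ^ (1 - q) * ∑ n, ∫⁻ x in K n, (‖f x‖ₑ + c) ^ q ∂μ := by
          gcongr with n
          rw [← setLIntegral_const]
          refine setLIntegral_mono' (hK n) fun x hx => ?_
          exact ENNReal.rpow_le_rpow (hv n x hx) hq0.le
      _ = D ^ q * e ^ (1 - q) * ∫⁻ x in ⋃ n, K n, (‖f x‖ₑ + c) ^ q ∂μ := by
          rw [lintegral_iUnion hK hKd, tsum_fintype]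
      _ ≤ _ := by
          gcongr
          exact iUnion_subset hKΩ
  have hHp : eLpNorm (fun x => H x ^ q⁻¹) p (μ.restrict Ω) ≤
      D * e ^ ((p⁻¹).toReal - 1) * eLpNorm (fun x => ‖f x‖ₑ + c) p (μ.restrict Ω) := by
    rw [eLpNorm_eq_lintegral_rpow_enorm_toReal hp0 hp', eLpNorm_eq_lintegral_rpow_enorm_toReal hp0 hp',
      ← hq]
    simp only [enorm_eq_self, ← ENNReal.rpow_mul, inv_mul_cancel₀ hq0.ne', ENNReal.rpow_one]
    calc (∫⁻ x in Ω, H x ∂μ) ^ (1 / q)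
        ≤ (D ^ q * e ^ (1 - q) * ∫⁻ x in Ω, (‖f x‖ₑ + c) ^ q ∂μ) ^ (1 / q) :=
          ENNReal.rpow_le_rpow hint (by positivity)
      _ = _ := by
          have hq2 : 0 ≤ 1 / q := by positivity
          rw [ENNReal.mul_rpow_of_nonneg _ _ hq2, ENNReal.mul_rpow_of_nonneg _ _ hq2,
            ← ENNReal.rpow_mul, ← ENNReal.rpow_mul, mul_one_div_cancel hq0.ne', ENNReal.rpow_one]
          congr 3
          rw [ENNReal.toReal_inv, ← hq]
          field_simp
  have hΩ : (μ.restrict Ω) univ = μ Ω := by simp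
  have s1 := eLpNorm_le_eLpNorm_add_const (μ := μ.restrict Ω) (hH.pow_const q⁻¹).aemeasurable c hp
    (Filter.Eventually.of_forall hpt)
  have s2 := eLpNorm_le_eLpNorm_add_const (μ := μ.restrict Ω) (g := fun x => ‖f x‖ₑ + c)
    hf.enorm.aemeasurable c hp (Filter.Eventually.of_forall fun x => le_rfl)
  rw [hΩ] at s1 s2
  rw [eLpNorm_enorm] at s2
  refine s1.trans ?_
  gcongr
  exact hHp.trans (by gcongr)

end

/-! ### Approximate solution of Du = f -/

section

variable {E : Type*} [NormedAddCommGroup E] [InnerProductSpace ℝ E] [FiniteDimensional ℝ E]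

/-- Every measurable vector field on an open set of finite measure is uniformly close, off a set of
small measure, to the gradient of a small `C¹` function, with almost sharp `L_p` bounds. -/
theorem exists_approximate_potential [MeasurableSpace E] [BorelSpace E] (μ : Measure E)
    [IsLocallyFiniteMeasure μ] {Ω : Set E} (hΩ : IsOpen Ω) (hfin : μ Ω ≠ ∞) (hne : μ Ω ≠ 0)
    {f : E → E} (hf : Measurable f) {ε δ : ℝ} (h0 : 0 < ε) (h1 : ε < 1) (hδ : 0 < δ) :
    ∃ (u : E → ℝ) (A : Set E), ContDiff ℝ 1 u ∧ HasCompactSupport u ∧ tsupport u ⊆ Ω ∧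
      IsOpen A ∧ A ⊆ Ω ∧ μ A ≤ ENNReal.ofReal (3 / 4 * ε) * μ Ω ∧ (∀ x, |u x| ≤ δ) ∧
      (∀ x ∈ Ω \ A, ‖f x - gradient u x‖ ≤ δ) ∧
      (∀ M, 0 ≤ M → (∀ᵐ x ∂μ.restrict Ω, ‖f x‖ ≤ M) →
        ∀ x, ‖gradient u x‖ ≤ 2 * (1 - ε / 4) / ε * (M + δ)) ∧
      ∀ p, 1 ≤ p → eLpNorm (gradient u) p (μ.restrict Ω) ≤ ENNReal.ofReal (2 * (1 - ε / 4)) *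
        ENNReal.ofReal ε ^ ((p⁻¹).toReal - 1) *
          (eLpNorm f p (μ.restrict Ω) + ENNReal.ofReal δ) := by
  set m := (μ Ω).toReal with hm
  have hm0 : 0 ≤ m := ENNReal.toReal_nonneg
  have hmΩ : μ Ω = ENNReal.ofReal m := (ENNReal.ofReal_toReal hfin).symm
  -- The `L_p` estimate over the pieces produces the error δ'(1 + |Ω|) twice; this choice makes the
  -- total δ.
  set δ' := δ / (2 * (1 + m)) with hδ'
  have hδ'0 : 0 < δ' := by positivity
  have hδ'm : 2 * (δ' * (1 + m)) = δ := by rw [hδ']; field_simp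
  have hδ'2 : 2 * δ' ≤ δ := by nlinarith
  obtain ⟨N, K, U, v, hK, hU, hKU, hUΩ, hUd, hUm, hU0, hv, hη⟩ :=
    exists_almost_constant_pieces μ hΩ hfin hf hδ'0
      (τ := ENNReal.ofReal (ε / 8)) (η := ENNReal.ofReal (ε / 8) * μ Ω)
      (ENNReal.ofReal_pos.2 (by positivity)).ne'
      (mul_ne_zero (ENNReal.ofReal_pos.2 (by positivity)).ne' hne)
  choose w B hw hwc hwU hBo hBU hBm hwδ hwB hwnB hwv using fun n =>
    exists_laminate_piece μ h0 h1 hδ'0 (hK n) (hU n) (hKU n)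
      (measure_ne_top_of_subset (hUΩ n) hfin) (v n)
  obtain ⟨hu, huc, hus, hug⟩ := glue_disjoint_supports hU hUd hw hwc hwU
  set u : E → ℝ := fun x => ∑ i, w i x
  have hout : ∀ x, x ∉ ⋃ n, U n → gradient u x = 0 := fun x hx =>
    gradient_of_notMem_tsupport fun h => hx (hus h)
  have h2 : 0 < 2 / ε - 2 := by
    have : 2 < 2 / ε := by rw [lt_div_iff₀ h0]; linarith
    linarith
  have hDe : 2 * (1 - ε / 4) / ε = 2 / ε - 1 / 2 := by
    field_simp
    norm_num
  have hKΩ : ∀ n, K n ⊆ Ω := fun n => (hKU n).trans (hUΩ n)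
  have hsup : ∀ M, 0 ≤ M → (∀ᵐ x ∂μ.restrict Ω, ‖f x‖ ≤ M) →
        ∀ x, ‖gradient u x‖ ≤ 2 * (1 - ε / 4) / ε * (M + δ) := by
    intro M hM hfM x
    rw [hDe]
    by_cases hx : x ∈ ⋃ n, U n
    · obtain ⟨n, hn⟩ := mem_iUnion.1 hx
      have hvM : ‖v n‖ ≤ M + δ' := by
        -- A nonempty `U n` has a non-null `K n`, which therefore contains a point where the
        -- essential bound on `f` holds.
        have hKn : μ (K n) ≠ 0 := fun h => by rw [hU0 n h] at hn; exact hn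
        obtain ⟨y, hyK, hyM⟩ : ∃ y ∈ K n, ‖f y‖ ≤ M := by
          by_contra! hcon
          apply hKn
          have := (ae_restrict_iff' hΩ.measurableSet).1 hfM
          refine measure_mono_null (fun y hy => ?_) this
          exact fun hy' => (hcon y hy).not_ge (hy' (hKΩ n hy))
        calc ‖v n‖ = ‖f y - (f y - v n)‖ := by rw [sub_sub_cancel]
          _ ≤ ‖f y‖ + ‖f y - v n‖ := norm_sub_le _ _
          _ ≤ M + δ' := add_le_add hyM (hv n y hyK)
      have hb : ‖gradient u x‖ ≤ δ' + (2 / ε - 1) * ‖v n‖ := by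
        rw [(hug n x hn).2]
        by_cases hxB : x ∈ B n
        · exact hwB n x hxB
        · refine (hwnB n x hxB).trans ?_
          nlinarith [norm_nonneg (v n)]
      refine hb.trans ?_
      nlinarith
    · rw [hout x hx, norm_zero]
      have : 0 < 2 / ε - 1 / 2 := by linarith
      positivity
  have hD1 : (1 : ℝ≥0∞) ≤ ENNReal.ofReal (2 * (1 - ε / 4)) := by
    rw [← ENNReal.ofReal_one]; exact ENNReal.ofReal_le_ofReal (by linarith)
  refine ⟨u, (Ω \ ⋃ n, K n) ∪ ⋃ n, B n, hu, huc, hus.trans (iUnion_subset hUΩ), ?_, ?_, ?_, ?_,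
    ?_, hsup, ?_⟩
  · exact (hΩ.sdiff (isClosed_iUnion_of_finite fun n => (hK n).isClosed)).union (isOpen_iUnion hBo)
  · exact union_subset sdiff_subset (iUnion_subset fun n => (hBU n).trans (hUΩ n))
  · have hsumU : ∑ n, μ (U n) ≤ μ Ω := by
      rw [← tsum_fintype (L := .unconditional _), ← measure_iUnion hUd fun n => (hU n).measurableSet]
      exact measure_mono (iUnion_subset hUΩ)
    calc μ ((Ω \ ⋃ n, K n) ∪ ⋃ n, B n) ≤ μ (Ω \ ⋃ n, K n) + ∑ n, μ (B n) :=
          (measure_union_le _ _).trans (add_le_add le_rfl (measure_iUnion_fintype_le _ _))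
      _ ≤ ENNReal.ofReal (ε / 8) * μ Ω +
          ∑ n, ENNReal.ofReal (ε / 2 * (1 + ε / 4)) * μ (U n) :=
          add_le_add hη (Finset.sum_le_sum fun n _ => hBm n)
      _ ≤ ENNReal.ofReal (ε / 8) * μ Ω + ENNReal.ofReal (ε / 2 * (1 + ε / 4)) * μ Ω := by
          rw [← Finset.mul_sum]; gcongr
      _ = ENNReal.ofReal (ε / 8 + ε / 2 * (1 + ε / 4)) * μ Ω := by
          rw [← add_mul, ENNReal.ofReal_add (by positivity) (by positivity)]
      _ ≤ _ := by
          gcongr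
          nlinarith
  · intro x
    by_cases hx : x ∈ ⋃ n, U n
    · obtain ⟨n, hn⟩ := mem_iUnion.1 hx
      rw [show u x = w n x from (hug n x hn).1]
      exact (hwδ n x).trans (by linarith)
    · rw [image_eq_zero_of_notMem_tsupport fun h => hx (hus h), abs_zero]
      exact hδ.le
  · rintro x ⟨hxΩ, hxA⟩
    simp only [mem_union, mem_sdiff, not_or, not_and, not_not] at hxA
    obtain ⟨n, hn⟩ := mem_iUnion.1 (hxA.1 hxΩ)
    have hxB : x ∉ B n := fun h => hxA.2 (mem_iUnion.2 ⟨n, h⟩)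
    rw [(hug n x (hKU n hn)).2]
    calc ‖f x - gradient (w n) x‖ = ‖(f x - v n) - (gradient (w n) x - v n)‖ := by
          rw [sub_sub_sub_cancel_right]
      _ ≤ ‖f x - v n‖ + ‖gradient (w n) x - v n‖ := norm_sub_le _ _
      _ ≤ δ' + δ' := add_le_add (hv n x hn) (hwv n x ⟨hn, hxB⟩)
      _ ≤ δ := by linarith
  · intro p hp
    have he1 := one_le_rpow_inv_toReal_sub_one h0 h1.le hp
    -- For p = ∞ the pointwise bound `hsup` applies if `f` is essentially bounded; otherwise the
    -- right side is `∞`.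
    by_cases hp' : p = ∞
    · subst hp'
      by_cases hfM : eLpNorm f ∞ (μ.restrict Ω) = ∞
      · rw [hfM, top_add, ENNReal.mul_top]
        · exact le_top
        · exact (zero_lt_one.trans_le (one_le_mul hD1 he1)).ne'
      · have hae : ∀ᵐ x ∂μ.restrict Ω, ‖f x‖ ≤ (eLpNorm f ∞ (μ.restrict Ω)).toReal := by
          filter_upwards [ae_le_eLpNormEssSup (f := f) (μ := μ.restrict Ω)] with x hx
          rw [← eLpNorm_exponent_top] at hx
          rw [← toReal_enorm]
          exact ENNReal.toReal_mono hfM hx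
        have := hsup _ ENNReal.toReal_nonneg hae
        calc eLpNorm (gradient u) ∞ (μ.restrict Ω) ≤ ENNReal.ofReal (2 * (1 - ε / 4) / ε *
              ((eLpNorm f ∞ (μ.restrict Ω)).toReal + δ)) := by
              rw [eLpNorm_exponent_top]
              exact eLpNormEssSup_le_of_ae_bound (Filter.Eventually.of_forall this)
          _ = _ := by
              rw [ENNReal.ofReal_mul (div_nonneg (by linarith) h0.le),
                ENNReal.ofReal_add ENNReal.toReal_nonneg hδ.le, ENNReal.ofReal_toReal hfM,
                div_eq_mul_inv, ENNReal.ofReal_mul (by linarith), ENNReal.ofReal_inv_of_pos h0]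
              simp [ENNReal.rpow_neg_one]
    · have hve : ∀ n, ∀ x ∈ K n, ‖v n‖ₑ ≤ ‖f x‖ₑ + ENNReal.ofReal δ' := by
        intro n x hx
        rw [← ofReal_norm, ← ofReal_norm, ← ENNReal.ofReal_add (norm_nonneg _) hδ'0.le]
        apply ENNReal.ofReal_le_ofReal
        calc ‖v n‖ = ‖f x - (f x - v n)‖ := by rw [sub_sub_cancel]
          _ ≤ ‖f x‖ + ‖f x - v n‖ := norm_sub_le _ _
          _ ≤ _ := add_le_add le_rfl (hv n x hx)
      have hin : ∀ n, ∀ x ∈ U n, ‖gradient u x‖ₑ ≤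
          ((B n).indicator (fun _ => ENNReal.ofReal (2 / ε - 2) * ‖v n‖ₑ) x + ‖v n‖ₑ) +
            ENNReal.ofReal δ' := by
        intro n x hx
        rw [(hug n x hx).2]
        by_cases hxB : x ∈ B n
        · rw [indicator_of_mem hxB, ← ofReal_norm, ← ofReal_norm, ← ENNReal.ofReal_mul h2.le,
            ← ENNReal.ofReal_add (by positivity) (norm_nonneg _),
            ← ENNReal.ofReal_add (by positivity) hδ'0.le]
          apply ENNReal.ofReal_le_ofReal
          linarith [hwB n x hxB]
        · rw [indicator_of_notMem hxB, zero_add, ← ofReal_norm, ← ofReal_norm,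
            ← ENNReal.ofReal_add (norm_nonneg _) hδ'0.le]
          apply ENNReal.ofReal_le_ofReal
          linarith [hwnB n x hxB]
      have hmain := eLpNorm_le_of_pieces μ h0 h1 (fun n => (hK n).measurableSet)
        (fun n => (hU n).measurableSet) (fun n => (hBo n).measurableSet) hKΩ hUΩ
        (fun i j hij => (hUd hij).mono (hKU i) (hKU j)) hBm hUm hf hve hin hout hp hp'
      refine hmain.trans ?_
      have hc : ENNReal.ofReal δ' * (1 + μ Ω) + ENNReal.ofReal δ' * (1 + μ Ω) =
          ENNReal.ofReal δ := by
        rw [hmΩ, ← ENNReal.ofReal_one, ← ENNReal.ofReal_add zero_le_one hm0,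
          ← ENNReal.ofReal_mul hδ'0.le, ← ENNReal.ofReal_add (by positivity) (by positivity),
          ← two_mul, hδ'm]
      rw [← hc, ← add_assoc, mul_add _ (_ + _)]
      exact add_le_add le_rfl <| le_mul_of_one_le_left zero_le (one_le_mul hD1 he1)

end

/-! ### Exact solution by iterating on the residual -/

section

variable {E : Type*} [NormedAddCommGroup E] [InnerProductSpace ℝ E] [FiniteDimensional ℝ E]

theorem ContDiff.continuous_gradient {u : E → ℝ} (hu : ContDiff ℝ 1 u) : Continuous (gradient u) :=
  (InnerProductSpace.toDual ℝ E).symm.continuous.comp (hu.continuous_fderiv one_ne_zero)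

theorem contDiff_tsum_of_gradient_le {u : ℕ → E → ℝ} (hu : ∀ n, ContDiff ℝ 1 (u n))
    (hs : ∀ x, Summable fun n => u n x) {b : ℕ → ℝ} (hb : Summable b)
    (hg : ∀ n x, ‖gradient (u n) x‖ ≤ b n) :
    ContDiff ℝ 1 (fun x => ∑' n, u n x) ∧
      ∀ x, HasSum (fun n => gradient (u n) x) (gradient (fun x => ∑' n, u n x) x) := by
  have hf : ∀ n x, ‖fderiv ℝ (u n) x‖ ≤ b n := fun n x => by
    rw [← LinearIsometryEquiv.norm_map (InnerProductSpace.toDual ℝ E).symm]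
    exact hg n x
  have hd : ∀ x, HasFDerivAt (fun x => ∑' n, u n x) (∑' n, fderiv ℝ (u n) x) x := fun x =>
    hasFDerivAt_tsum hb (fun n x => ((hu n).differentiable one_ne_zero x).hasFDerivAt) hf (hs 0) x
  have hfd : fderiv ℝ (fun x => ∑' n, u n x) = fun x => ∑' n, fderiv ℝ (u n) x :=
    funext fun x => (hd x).fderiv
  refine ⟨?_, fun x => ?_⟩
  · rw [contDiff_one_iff_fderiv, hfd]
    exact ⟨fun x => (hd x).differentiableAt,
      continuous_tsum (fun n => (hu n).continuous_fderiv one_ne_zero) hb hf⟩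
  · rw [gradient, hfd]
    have : Summable fun n => fderiv ℝ (u n) x := .of_norm_bounded hb fun n => hf n x
    exact this.hasSum.map (InnerProductSpace.toDual ℝ E).symm
      (InnerProductSpace.toDual ℝ E).symm.continuous

/-- Every measurable vector field on an open set of finite measure agrees, off a set of
small measure, with the gradient of a `C¹` function, with almost sharp `L_p` bounds. -/
theorem exists_exact_potential [MeasurableSpace E] [BorelSpace E] (μ : Measure E)
    [IsLocallyFiniteMeasure μ] {Ω : Set E} (hΩ : IsOpen Ω) (hfin : μ Ω ≠ ∞) (hne : μ Ω ≠ 0)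
    {f : E → E} (hf : Measurable f) {ε δ : ℝ} (h0 : 0 < ε) (h1 : ε < 1) (hδ : 0 < δ) :
    ∃ (u : E → ℝ) (A : Set E), ContDiff ℝ 1 u ∧ tsupport u ⊆ closure Ω ∧ (∀ x ∉ Ω, gradient u x = 0) ∧
      IsOpen A ∧ A ⊆ Ω ∧ μ A ≤ ENNReal.ofReal (6 / 7 * ε) * μ Ω ∧
      (∀ x ∈ Ω \ A, gradient u x = f x) ∧
      ∀ p, 1 ≤ p → eLpNorm (gradient u) p (μ.restrict Ω) ≤ ENNReal.ofReal (2 * (1 - ε / 4)) *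
        ENNReal.ofReal ε ^ ((p⁻¹).toReal - 1) *
          (eLpNorm f p (μ.restrict Ω) + ENNReal.ofReal δ) + ENNReal.ofReal δ * (1 + μ Ω) := by
  -- The proportions e_n sum to 8ε/7, so the exceptional sets use (3/4)(8/7) = 6/7 of ε. The
  -- tolerances s_n decay faster, so that the gradient bounds of order s_n / e_(n+1) for the
  -- corrections remain summable.
  let e : ℕ → ℝ := fun n => ε * (1 / 8) ^ n
  let s : ℕ → ℝ := fun n => δ * ε / 64 * (1 / 16) ^ n
  have he0 : ∀ n, 0 < e n := fun n => by positivity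
  have he1 : ∀ n, e n < 1 := fun n => by
    have : (1 / 8 : ℝ) ^ n ≤ 1 := pow_le_one₀ (by norm_num) (by norm_num)
    have h3 : (0 : ℝ) < (1 / 8 : ℝ) ^ n := by positivity
    simp only [e]; nlinarith
  have hs0 : ∀ n, 0 < s n := fun n => by positivity
  have hsle : ∀ n, s n ≤ δ := fun n => by
    have : (1 / 16 : ℝ) ^ n ≤ 1 := pow_le_one₀ (by norm_num) (by norm_num)
    calc s n ≤ δ * ε / 64 * 1 := by simp only [s]; gcongr
      _ ≤ δ := by nlinarith
  have hssum : Summable s :=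
    (summable_geometric_of_lt_one (by norm_num) (by norm_num)).mul_left _
  choose w B hw hwc hws hBo hBΩ hBm hwδ hwB hwM hwp using
    fun (n : ℕ) (g : {g : E → E // Measurable g}) =>
      exists_approximate_potential μ hΩ hfin hne g.2 (he0 n) (he1 n) (hs0 n)
  -- `G n` is the field still to be matched. Setting the residual to zero on the bad set makes it
  -- uniformly at most s_n, which is what bounds the next gradient.
  let G : ℕ → {g : E → E // Measurable g} := fun n =>
    Nat.rec ⟨f, hf⟩ (fun n g => ⟨(Ω \ B n g).indicator (fun x => g.1 x - gradient (w n g) x),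
      (g.2.sub (hw n g).continuous_gradient.measurable).indicator
        (hΩ.measurableSet.diff (hBo n g).measurableSet)⟩) n
  have hG : ∀ n, (G (n + 1)).1 = (Ω \ B n (G n)).indicator
      (fun x => (G n).1 x - gradient (w n (G n)) x) := fun n => rfl
  have hGs : ∀ n x, ‖(G (n + 1)).1 x‖ ≤ s n := by
    intro n x
    rw [hG]
    by_cases hx : x ∈ Ω \ B n (G n)
    · rw [indicator_of_mem hx]; exact hwB n (G n) x hx
    · rw [indicator_of_notMem hx, norm_zero]; exact (hs0 n).le
  let u : ℕ → E → ℝ := fun n => w n (G n)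
  let A : Set E := ⋃ n, B n (G n)
  have hsum : ∀ n, ∀ x ∈ Ω \ A, (G n).1 x + ∑ k ∈ Finset.range n, gradient (u k) x = f x := by
    intro n x hx
    induction n with
    | zero => simp [G]
    | succ n ih =>
      have hxB : x ∈ Ω \ B n (G n) := ⟨hx.1, fun h => hx.2 (mem_iUnion.2 ⟨n, h⟩)⟩
      rw [Finset.sum_range_succ, hG, indicator_of_mem hxB, ← ih]
      simp only [u]
      abel
  let b : ℕ → ℝ := fun n => δ / 2 * (1 / 2) ^ n
  have hb : HasSum b δ := by
    have := hasSum_geometric_two.mul_left (δ / 2)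
    simpa [b] using this
  have hgb : ∀ n x, ‖gradient (u (n + 1)) x‖ ≤ b n := by
    intro n x
    refine (hwM (n + 1) (G (n + 1)) (s n) (hs0 n).le
      (Filter.Eventually.of_forall (hGs n)) x).trans ?_
    have h3 : s (n + 1) ≤ s n := by
      simp only [s, pow_succ]
      have : 0 < δ * ε / 64 * (1 / 16) ^ n := by positivity
      linarith
    calc 2 * (1 - e (n + 1) / 4) / e (n + 1) * (s n + s (n + 1))
        ≤ 2 / e (n + 1) * (2 * s n) := by
          have := he0 (n + 1)
          have := he1 (n + 1)
          have := hs0 n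
          have := hs0 (n + 1)
          refine mul_le_mul ?_ (by linarith) (by positivity) (by positivity)
          gcongr
          linarith
      _ = b n := by
          simp only [e, s, b, pow_succ]
          have h16 : (1 / 16 : ℝ) ^ n = (1 / 8) ^ n * (1 / 2) ^ n := by
            rw [← mul_pow]; norm_num
          rw [h16]
          have : (1 / 8 : ℝ) ^ n ≠ 0 := by positivity
          field_simp
          norm_num
  have hus : ∀ x, Summable fun n => u (n + 1) x := fun x =>
    .of_norm_bounded ((summable_nat_add_iff 1).2 hssum) fun n => hwδ (n + 1) (G (n + 1)) x
  obtain ⟨hWc, hWg⟩ := contDiff_tsum_of_gradient_le (fun n => hw (n + 1) (G (n + 1))) hus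
    hb.summable hgb
  replace hWg : ∀ x, HasSum (fun n => gradient (u (n + 1)) x)
      (gradient (fun x => ∑' n, u (n + 1) x) x) := hWg
  set W : E → ℝ := fun x => ∑' n, u (n + 1) x
  have hu0 : ContDiff ℝ 1 (u 0) := hw 0 (G 0)
  have hgrad : ∀ x, gradient (fun x => u 0 x + W x) x = gradient (u 0) x + gradient W x := by
    intro x
    have := ((hu0.differentiable one_ne_zero x).hasFDerivAt.add
      (hWc.differentiable one_ne_zero x).hasFDerivAt).fderiv
    simp only [gradient]
    rw [← map_add]
    exact congrArg _ this
  have hWδ : ∀ x, ‖gradient W x‖ ≤ δ := fun x =>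
    (hWg x).tsum_eq ▸ tsum_of_norm_bounded hb fun n => hgb n x
  have huΩ : ∀ n x, x ∉ Ω → u n x = 0 := fun n x hx =>
    image_eq_zero_of_notMem_tsupport fun h => hx (hws n (G n) h)
  have hgΩ : ∀ n x, x ∉ Ω → gradient (u n) x = 0 := fun n x hx =>
    gradient_of_notMem_tsupport fun h => hx (hws n (G n) h)
  refine ⟨fun x => u 0 x + W x, A, hu0.add hWc, ?_, ?_, isOpen_iUnion fun n => hBo n _,
    iUnion_subset fun n => hBΩ n _, ?_, ?_, ?_⟩
  · refine closure_mono fun x hx => ?_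
    by_contra hx'
    exact hx (by simp [W, huΩ _ x hx'])
  · intro x hx
    rw [hgrad, ← (hWg x).tsum_eq]
    simp only [hgΩ _ x hx, tsum_zero, add_zero]
  · calc μ A ≤ ∑' n, μ (B n (G n)) := measure_iUnion_le _
      _ ≤ ∑' n, ENNReal.ofReal (3 / 4 * e n) * μ Ω := ENNReal.tsum_le_tsum fun n => hBm n _
      _ = ENNReal.ofReal (∑' n, 3 / 4 * e n) * μ Ω := by
          rw [ENNReal.tsum_mul_right, ENNReal.ofReal_tsum_of_nonneg]
          · exact fun n => by have := he0 n; positivity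
          · exact ((summable_geometric_of_lt_one (by norm_num) (by norm_num)).mul_left _).mul_left _
      _ = ENNReal.ofReal (6 / 7 * ε) * μ Ω := by
          simp only [e]
          rw [tsum_mul_left, tsum_mul_left, tsum_geometric_of_lt_one (by norm_num) (by norm_num)]
          congr 2
          ring
  · intro x hx
    -- Off `A` the residual plus the gradients used so far always equals `f`, and the residual tends
    -- to zero.
    have t1 : Filter.Tendsto (fun n => (G (n + 1)).1 x) Filter.atTop (nhds 0) :=
      squeeze_zero_norm (fun n => hGs n x) hssum.tendsto_atTop_zero
    have t2 := (hWg x).tendsto_sum_nat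
    have t3 := (t1.add t2).const_add (gradient (u 0) x)
    rw [zero_add] at t3
    rw [hgrad]
    refine tendsto_nhds_unique t3 (tendsto_const_nhds.congr fun n => ?_)
    rw [← hsum (n + 1) x hx, Finset.sum_range_succ']
    simp only [u]
    abel
  · intro p hp
    -- Only the first potential pays the sharp constant; all later ones together add at most δ
    -- pointwise.
    calc eLpNorm (gradient fun x => u 0 x + W x) p (μ.restrict Ω)
        ≤ eLpNorm (fun x => ‖gradient (u 0) x‖ₑ) p (μ.restrict Ω) +
            ENNReal.ofReal δ * (1 + (μ.restrict Ω) univ) := by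
          refine eLpNorm_le_eLpNorm_add_const
            hu0.continuous_gradient.measurable.enorm.aemeasurable _ hp
            (Filter.Eventually.of_forall fun x => ?_)
          rw [hgrad]
          refine (enorm_add_le _ _).trans (add_le_add le_rfl ?_)
          rw [← ofReal_norm]
          exact ENNReal.ofReal_le_ofReal (hWδ x)
      _ ≤ _ := by
          rw [eLpNorm_enorm, Measure.restrict_apply_univ]
          gcongr
          refine (hwp 0 (G 0) p hp).trans ?_
          simp only [e, pow_zero, mul_one]
          gcongr
          · exact le_rfl
          · exact hsle 0

end

/-! ### Existence of Lusin pairs with constant 2 -/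

section

/-- The `L_p` norms on a finite measure space, `1 ≤ p ≤ ∞`, are controlled from below by the `L_1`
norm. -/
theorem eLpNorm_one_le_mul_one_add {X F : Type*} [MeasurableSpace X] [NormedAddCommGroup F]
    {μ : Measure X} {f : X → F} (hf : AEStronglyMeasurable f μ) {p : ℝ≥0∞} (hp : 1 ≤ p) :
    eLpNorm f 1 μ ≤ eLpNorm f p μ * (1 + μ univ) := by
  refine (eLpNorm_le_eLpNorm_mul_rpow_measure_univ hp hf).trans ?_
  gcongr
  have h1 : 1 / p.toReal ≤ 1 := by
    rw [one_div, ← ENNReal.toReal_inv, ← ENNReal.toReal_one]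
    exact ENNReal.toReal_mono ENNReal.one_ne_top (ENNReal.inv_le_one.2 hp)
  have h2 : 0 ≤ 1 / p.toReal := by positivity
  refine rpow_inv_le_one_add _ ?_ ?_ <;> simp only [ENNReal.toReal_one, div_one] <;> linarith

theorem measurable_indicator_of_domRestrict {X Y : Type*} [MeasurableSpace X] [MeasurableSpace Y]
    [Zero Y] {s : Set X} (hs : MeasurableSet s) {f : X → Y} (hf : Measurable (s.domRestrict f)) :
    Measurable (s.indicator f) := by
  refine measurable_of_restrict_of_restrict_compl hs ?_ ?_
  · convert hf using 1
    ext x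
    simp
  · convert measurable_const (a := (0 : Y)) using 1
    ext x
    exact indicator_of_notMem x.2 f

variable {d : ℕ} {Ω : Set (EuclideanSpace ℝ (Fin d))}
  {f : EuclideanSpace ℝ (Fin d) → EuclideanSpace ℝ (Fin d)} {ε : ℝ}

/-- Covers the degenerate cases in which u = 0 solves the problem, whatever the constant: ε ≥ 1, Ω
null, or f = 0 almost everywhere. -/
theorem isLusinPair_zero {A : Set (EuclideanSpace ℝ (Fin d))} (hA : IsOpen A) (hAΩ : A ⊆ Ω)
    (hm : volume A ≤ ENNReal.ofReal ε * volume Ω) (hf : ∀ x ∈ Ω \ A, f x = 0) (K : ℝ≥0∞) :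
    ∃ A u, IsLusinPair Ω f ε A u ∧ ∀ p, 1 ≤ p → LusinLpBound K Ω f ε u p := by
  have hg : gradient (fun _ : EuclideanSpace ℝ (Fin d) => (0 : ℝ)) = 0 := by
    ext1 x
    exact gradient_fun_const x 0
  refine ⟨A, fun _ => 0, ⟨hA, hAΩ, hm, contDiff_const, HasCompactSupport.zero, ?_, fun x hx => ?_⟩,
    fun p _ => ?_⟩
  · rw [show (fun _ => (0 : ℝ)) = (0 : EuclideanSpace ℝ (Fin d) → ℝ) from rfl,
      tsupport_eq_empty_iff.2 rfl]
    exact empty_subset _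
  · rw [hg, hf x hx]; rfl
  · rw [LusinLpBound, hg, eLpNorm_zero]; exact zero_le

theorem exists_isLusinPair_bound_two (hΩ : IsOpen Ω) (hfin : volume Ω < ∞)
    (hf : Measurable (Ω.domRestrict f)) (h0 : 0 < ε) :
    ∃ A u, IsLusinPair Ω f ε A u ∧ ∀ p, 1 ≤ p → LusinLpBound 2 Ω f ε u p := by
  by_cases htriv : volume Ω ≤ ENNReal.ofReal ε * volume Ω
  · exact isLusinPair_zero hΩ Subset.rfl htriv (fun x hx => absurd hx.1 hx.2) 2
  have hne : volume Ω ≠ 0 := fun h => htriv (by simp [h])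
  have h1 : ε < 1 := by
    by_contra! h
    exact htriv (le_mul_of_one_le_left zero_le (ENNReal.one_le_ofReal.2 h))
  have hF : Measurable (Ω.indicator f) := measurable_indicator_of_domRestrict hΩ.measurableSet hf
  have hFf : ∀ p, eLpNorm (Ω.indicator f) p (volume.restrict Ω) =
      eLpNorm f p (volume.restrict Ω) := fun p =>
    eLpNorm_congr_ae (indicator_ae_eq_restrict hΩ.measurableSet)
  have hFΩ : ∀ x ∈ Ω, Ω.indicator f x = f x := fun x hx => indicator_of_mem hx f
  generalize hFdef : Ω.indicator f = F at *
  -- If f = 0 almost everywhere, the right side of the estimate is 0 and no positive error can be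
  -- absorbed, so this case is separate.
  by_cases hzero : eLpNorm f 1 (volume.restrict Ω) = 0
  · rw [← hFf, eLpNorm_eq_zero_iff hF.aestronglyMeasurable one_ne_zero] at hzero
    have hnull : volume {x ∈ Ω | F x ≠ 0} = 0 := by
      have := (ae_restrict_iff' hΩ.measurableSet).1 hzero
      refine measure_mono_null (fun x hx => ?_) this
      exact fun h => hx.2 (h hx.1)
    obtain ⟨V, hSV, hVo, hV⟩ := Set.exists_isOpen_lt_of_lt {x ∈ Ω | F x ≠ 0}
      (ENNReal.ofReal ε * volume Ω) (by
        rw [hnull]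
        exact ENNReal.mul_pos (ENNReal.ofReal_pos.2 h0).ne' hne)
    refine isLusinPair_zero (hVo.inter hΩ) inter_subset_right
      ((measure_mono inter_subset_left).trans hV.le) (fun x hx => ?_) 2
    by_contra hfx
    exact hx.2 ⟨hSV ⟨hx.1, by rwa [hFΩ x hx.1]⟩, hx.1⟩
  set m := (volume Ω).toReal with hm
  have hm0 : 0 ≤ m := ENNReal.toReal_nonneg
  have hmΩ : volume Ω = ENNReal.ofReal m := (ENNReal.ofReal_toReal hfin.ne).symm
  -- Truncation at 1 keeps `I` finite when `f` is not integrable.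
  set I := (min (eLpNorm f 1 (volume.restrict Ω)) 1).toReal with hI
  have hIle : ENNReal.ofReal I ≤ eLpNorm f 1 (volume.restrict Ω) := by
    rw [hI, ENNReal.ofReal_toReal (ne_top_of_le_ne_top ENNReal.one_ne_top (min_le_right _ _))]
    exact min_le_left _ _
  have hI0 : 0 < I := ENNReal.toReal_pos
    (by simp [min_eq_iff, hzero]) (ne_top_of_le_ne_top ENNReal.one_ne_top (min_le_right _ _))
  -- Chosen so that δ(3 + m), the total additive error after factoring out ε^(1/p-1), is at most
  -- (ε/2)|f|_p for every p ≥ 1. This restores 2(1 - ε/4) to 2.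
  set δ := ε / 2 * I / ((3 + m) * (1 + m)) with hδ
  have hδ0 : 0 < δ := by positivity
  have hδI : δ * (3 + m) * (1 + m) = ε / 2 * I := by rw [hδ]; field_simp
  have hlow : ∀ p, 1 ≤ p → ENNReal.ofReal (δ * (3 + m)) ≤
      ENNReal.ofReal (ε / 2) * eLpNorm f p (volume.restrict Ω) := by
    intro p hp
    have hAE : AEStronglyMeasurable f (volume.restrict Ω) :=
      hF.aestronglyMeasurable.congr (by
        rw [← hFdef]; exact indicator_ae_eq_restrict hΩ.measurableSet)
    have s1 := hIle.trans (eLpNorm_one_le_mul_one_add hAE hp)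
    rw [Measure.restrict_apply_univ, hmΩ, ← ENNReal.ofReal_one,
      ← ENNReal.ofReal_add zero_le_one hm0] at s1
    have hm1 : ENNReal.ofReal (1 + m) ≠ 0 := (ENNReal.ofReal_pos.2 (by positivity)).ne'
    rw [← ENNReal.mul_le_mul_iff_left hm1 ENNReal.ofReal_ne_top,
      ← ENNReal.ofReal_mul (by positivity), hδI, ENNReal.ofReal_mul (by positivity), mul_assoc]
    gcongr
  have hη : ENNReal.ofReal (ε / 7) * volume Ω ≠ 0 :=
    mul_ne_zero (ENNReal.ofReal_pos.2 (by positivity)).ne' hne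
  obtain ⟨C, hCΩ, hC, hCm⟩ := hΩ.measurableSet.exists_isCompact_sdiff_lt hfin.ne hη
  -- The infinite sum of potentials is only known to be supported in the closure of its domain.
  -- Working in a relatively compact Ω' gives compact support in Ω, and Ω \ C uses the remaining
  -- ε/7.
  obtain ⟨Ω', hΩ'o, hCΩ', hΩ'Ω, hΩ'c⟩ := exists_open_between_and_isCompact_closure hC hΩ hCΩ
  have hsub : Ω' ⊆ Ω := subset_closure.trans hΩ'Ω
  have hne' : volume Ω' ≠ 0 := by
    intro h
    have hC0 : volume C = 0 := measure_mono_null hCΩ' h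
    rw [measure_sdiff_null hC0] at hCm
    refine hCm.not_ge ?_
    calc ENNReal.ofReal (ε / 7) * volume Ω ≤ 1 * volume Ω := by
          gcongr
          rw [← ENNReal.ofReal_one]
          exact ENNReal.ofReal_le_ofReal (by linarith)
      _ = _ := one_mul _
  obtain ⟨u, A, hu, hus, hu0, hA, hAΩ', hAm, hgrad, hLp⟩ := exists_exact_potential volume hΩ'o
    (measure_ne_top_of_subset hsub hfin.ne) hne' hF h0 h1 hδ0
  refine ⟨(Ω \ C) ∪ A, u, ⟨(hΩ.sdiff hC.isClosed).union hA,
    union_subset sdiff_subset (hAΩ'.trans hsub), ?_, hu,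
    hΩ'c.of_isClosed_subset (isClosed_tsupport _) hus, hus.trans hΩ'Ω, ?_⟩, ?_⟩
  · calc volume ((Ω \ C) ∪ A) ≤ volume (Ω \ C) + volume A := measure_union_le _ _
      _ ≤ ENNReal.ofReal (ε / 7) * volume Ω + ENNReal.ofReal (6 / 7 * ε) * volume Ω :=
          add_le_add hCm.le (hAm.trans (by gcongr))
      _ = ENNReal.ofReal ε * volume Ω := by
          rw [← add_mul, ← ENNReal.ofReal_add (by positivity) (by positivity)]
          congr 2
          ring
  · rintro x ⟨hx, hxA⟩
    simp only [mem_union, mem_sdiff, not_or, not_and, not_not] at hxA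
    rw [hgrad x ⟨hCΩ' (hxA.1 hx), hxA.2⟩, hFΩ x hx]
  · intro p hp
    have hsupp : Function.support (gradient u) ⊆ Ω' := fun x hx => by
      by_contra hx'
      exact hx (hu0 x hx')
    have hX := one_le_rpow_inv_toReal_sub_one h0 h1.le hp
    have hlowp := hlow p hp
    have hLpp := hLp p hp
    have hFle : eLpNorm F p (volume.restrict Ω') ≤ eLpNorm f p (volume.restrict Ω) := by
      rw [← hFf]
      exact eLpNorm_mono_measure _ (Measure.restrict_mono hsub le_rfl)
    rw [LusinLpBound, eLpNorm_restrict_eq_of_support_subset (hsupp.trans hsub),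
      ← eLpNorm_restrict_eq_of_support_subset hsupp]
    refine hLpp.trans ?_
    set Y := eLpNorm f p (volume.restrict Ω)
    set X := ENNReal.ofReal ε ^ ((p⁻¹).toReal - 1)
    have hD2 : ENNReal.ofReal (2 * (1 - ε / 4)) ≤ 2 := by
      rw [← ENNReal.ofReal_ofNat 2]; exact ENNReal.ofReal_le_ofReal (by linarith)
    calc ENNReal.ofReal (2 * (1 - ε / 4)) * X * (eLpNorm F p (volume.restrict Ω') +
          ENNReal.ofReal δ) + ENNReal.ofReal δ * (1 + volume Ω')
        ≤ ENNReal.ofReal (2 * (1 - ε / 4)) * X * (Y + ENNReal.ofReal δ) +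
            ENNReal.ofReal δ * (1 + volume Ω) := by gcongr
      _ = ENNReal.ofReal (2 * (1 - ε / 4)) * X * Y +
            (ENNReal.ofReal (2 * (1 - ε / 4)) * (X * ENNReal.ofReal δ) +
              1 * (ENNReal.ofReal δ * (1 + volume Ω))) := by ring
      _ ≤ ENNReal.ofReal (2 * (1 - ε / 4)) * X * Y +
            (2 * (X * ENNReal.ofReal δ) + X * (ENNReal.ofReal δ * (1 + volume Ω))) := by gcongr
      _ = ENNReal.ofReal (2 * (1 - ε / 4)) * X * Y + X * ENNReal.ofReal (δ * (3 + m)) := by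
          rw [hmΩ, ENNReal.ofReal_mul hδ0.le, ENNReal.ofReal_add (by norm_num) hm0,
            ENNReal.ofReal_ofNat]
          ring
      _ ≤ ENNReal.ofReal (2 * (1 - ε / 4)) * X * Y + X * (ENNReal.ofReal (ε / 2) * Y) := by gcongr
      _ = (ENNReal.ofReal (2 * (1 - ε / 4)) + ENNReal.ofReal (ε / 2)) * X * Y := by ring
      _ = 2 * X * Y := by
          rw [← ENNReal.ofReal_add (by linarith) (by linarith), ← ENNReal.ofReal_ofNat 2]
          congr 3
          ring

end

/-! ### Lower bound from the vanishing mean of the gradient -/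

section

/-- Integration by parts against the constant function 1. -/
theorem integral_inner_gradient_eq_zero {E : Type*} [NormedAddCommGroup E] [InnerProductSpace ℝ E]
    [FiniteDimensional ℝ E] [MeasurableSpace E] [BorelSpace E] {u : E → ℝ} (hu : ContDiff ℝ 1 u)
    (hc : HasCompactSupport u) (v : E) :
    Integrable (fun x => inner ℝ v (gradient u x)) ∧ ∫ x, inner ℝ v (gradient u x) = 0 := by
  have hint : Integrable (fun x => inner ℝ v (gradient u x)) := by
    refine (continuous_const.inner hu.continuous_gradient).integrable_of_hasCompactSupport ?_
    refine hc.mono' fun x hx => ?_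
    by_contra hx'
    exact hx (by simp only [gradient_of_notMem_tsupport hx', inner_zero_right])
  refine ⟨hint, ?_⟩
  have := integral_bilinear_hasLineDerivAt_right_eq_neg_left_of_integrable (μ := (volume : Measure E))
    (f := fun _ => (1 : ℝ)) (f' := fun _ => (0 : ℝ)) (g := u)
    (g' := fun x => inner ℝ v (gradient u x)) (v := v) (B := ContinuousLinearMap.mul ℝ ℝ)
    (by simp) (by simpa using hint)
    (by simpa using hu.continuous.integrable_of_hasCompactSupport hc)
    (fun x _ => by simpa using (hasFDerivAt_const (1 : ℝ) x).hasLineDerivAt v)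
    (fun x _ => by
      have h := ((hu.differentiable one_ne_zero) x).hasFDerivAt.hasLineDerivAt v
      rw [real_inner_comm, inner_gradient_left]
      exact h)
  simpa using this

variable {d : ℕ} {Ω A : Set (EuclideanSpace ℝ (Fin d))} {u : EuclideanSpace ℝ (Fin d) → ℝ}
  {ε : ℝ}

/-- Since `∫ Du = 0`, solving the Lusin problem for a constant unit field costs twice the measure of
the set on which it is solved. -/
theorem IsLusinPair.two_mul_le_eLpNorm_one {v : EuclideanSpace ℝ (Fin d)} (hv : ‖v‖ = 1)
    (h : IsLusinPair Ω (fun _ => v) ε A u) (hΩ : IsOpen Ω) (hvol : volume Ω = 1) (h0 : 0 < ε)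
    (h1 : ε < 1) :
    ENNReal.ofReal (2 * (1 - ε)) ≤ eLpNorm (gradient u) 1 (volume.restrict Ω) := by
  obtain ⟨hint, hzero⟩ := integral_inner_gradient_eq_zero h.contDiff h.hasCompactSupport v
  have hAm := h.isOpen.measurableSet
  have hDm : MeasurableSet (Ω \ A) := hΩ.measurableSet.diff hAm
  have hDfin : volume (Ω \ A) ≠ ∞ := measure_ne_top_of_subset sdiff_subset (by simp [hvol])
  have hD : ENNReal.ofReal (1 - ε) ≤ volume (Ω \ A) := by
    rw [ENNReal.ofReal_sub _ h0.le, ENNReal.ofReal_one, tsub_le_iff_left]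
    calc 1 = volume Ω := hvol.symm
      _ ≤ volume A + volume (Ω \ A) := by
          rw [← measure_union disjoint_sdiff_right hDm]
          exact measure_mono (by intro x hx; by_cases hxA : x ∈ A <;> simp [hx, hxA])
      _ ≤ _ := by
          gcongr
          simpa [hvol] using h.volume_le
  have hcompl : ∫ x in Aᶜ, inner ℝ v (gradient u x) = (volume (Ω \ A)).toReal := by
    have : ∫ x in Aᶜ, inner ℝ v (gradient u x) =
        ∫ x in Aᶜ, (Ω \ A).indicator (fun _ => (1 : ℝ)) x := by
      refine setIntegral_congr_fun hAm.compl fun x hx => ?_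
      by_cases hxΩ : x ∈ Ω
      · simp only [indicator_of_mem (show x ∈ Ω \ A from ⟨hxΩ, hx⟩), h.gradient_eq x ⟨hxΩ, hx⟩,
          real_inner_self_eq_norm_sq, hv, one_pow]
      · simp only [indicator_of_notMem (show x ∉ Ω \ A from fun h => hxΩ h.1),
          gradient_of_notMem_tsupport fun h' => hxΩ (h.tsupport_subset h'), inner_zero_right]
    rw [this, integral_indicator hDm, Measure.restrict_restrict hDm,
      inter_eq_left.2 (fun x hx => hx.2)]
    simp [Measure.real]
  -- The component of Du along `v` integrates to |Ω \ A| over the complement of `A`, so its integral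
  -- over `A` must cancel that.
  have hAint : volume (Ω \ A) ≤ ∫⁻ x in A, ‖gradient u x‖ₑ := by
    have e1 : ∫ x in A, inner ℝ v (gradient u x) = -(volume (Ω \ A)).toReal := by
      have := integral_add_compl hAm hint
      rw [hzero, hcompl] at this
      linarith
    calc volume (Ω \ A) = ‖∫ x in A, inner ℝ v (gradient u x)‖ₑ := by
          rw [e1, enorm_neg, ← ofReal_norm, Real.norm_of_nonneg ENNReal.toReal_nonneg,
            ENNReal.ofReal_toReal hDfin]
      _ ≤ ∫⁻ x in A, ‖(inner ℝ v (gradient u x) : ℝ)‖ₑ := enorm_integral_le_lintegral_enorm _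
      _ ≤ _ := by
          refine lintegral_mono fun x => ?_
          rw [← ofReal_norm, ← ofReal_norm]
          refine ENNReal.ofReal_le_ofReal ((norm_inner_le_norm _ _).trans ?_)
          rw [hv, one_mul]
  calc ENNReal.ofReal (2 * (1 - ε)) = ENNReal.ofReal (1 - ε) + ENNReal.ofReal (1 - ε) := by
        rw [← ENNReal.ofReal_add (by linarith) (by linarith), two_mul]
    _ ≤ volume (Ω \ A) + volume (Ω \ A) := add_le_add hD hD
    _ ≤ (∫⁻ x in Ω \ A, ‖gradient u x‖ₑ) + ∫⁻ x in A, ‖gradient u x‖ₑ := by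
        refine add_le_add (le_of_eq ?_) hAint
        rw [setLIntegral_congr_fun (g := fun _ => 1) hDm fun x hx => ?_]
        · simp
        · simp only [h.gradient_eq x hx]
          rw [← ofReal_norm, hv, ENNReal.ofReal_one]
    _ = ∫⁻ x in (Ω \ A) ∪ A, ‖gradient u x‖ₑ := (lintegral_union hAm disjoint_sdiff_left).symm
    _ = eLpNorm (gradient u) 1 (volume.restrict Ω) := by
        rw [sdiff_union_of_subset h.subset, eLpNorm_one_eq_lintegral_enorm]

end

/-! ### Grand Lebesgue estimates and sharpness -/

/-- The `L_p` estimates with constant `K` imply the Grand Lebesgue estimate with constant `K`. -/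
theorem glsNorm_gradient_le {d : ℕ} {K : ℝ≥0∞} {Ω : Set (EuclideanSpace ℝ (Fin d))}
    {f : EuclideanSpace ℝ (Fin d) → EuclideanSpace ℝ (Fin d)} {ε : ℝ}
    {u : EuclideanSpace ℝ (Fin d) → ℝ} (h0 : 0 < ε)
    (h : ∀ p, 1 < p → p < ∞ → LusinLpBound K Ω f ε u p) {a b : ℝ≥0∞} {ψ ζ : ℝ≥0∞ → ℝ≥0∞}
    (hψ : IsPsiFunction a b ψ) (hζ : IsPsiFunction a b ζ) :
    glsNorm (volume.restrict Ω) (fun p => ζ p * ψ p) (gradient u) ≤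
      K * (ENNReal.ofReal ε)⁻¹ * glsFundamental ζ (ENNReal.ofReal ε) *
        glsNorm (volume.restrict Ω) ψ f := by
  have he0 : ENNReal.ofReal ε ≠ 0 := (ENNReal.ofReal_pos.2 h0).ne'
  have hne : ∀ {χ : ℝ≥0∞ → ℝ≥0∞}, IsPsiFunction a b χ → ∀ p ∈ Ioo a b, χ p ≠ 0 := fun hχ p hp =>
    (hχ.iInf_pos.trans_le (iInf₂_le p hp)).ne'
  refine iSup₂_le fun p hp => ?_
  -- Off (a, b) both factors are `∞`, so the product is finite only inside (a, b).
  have hpI : p ∈ Ioo a b := by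
    by_contra hp'
    have h1 : ψ p = ∞ := by
      by_contra h
      exact hp' (hψ.supp_eq ▸ lt_top_iff_ne_top.2 h)
    have h2 : ζ p = ∞ := by
      by_contra h
      exact hp' (hζ.supp_eq ▸ lt_top_iff_ne_top.2 h)
    simp [h1, h2] at hp
  have hψp : p ∈ {p | ψ p < ∞} := hψ.supp_eq ▸ hpI
  have hζp : p ∈ {p | ζ p < ∞} := hζ.supp_eq ▸ hpI
  have hb := h p (hψ.one_le.trans_lt hpI.1) (hpI.2.trans_le le_top)
  -- Writing ε^(1/p-1) as ε^(1/p)/ε splits the bound into a term of the fundamental function of ζ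
  -- and a term of the norm of `f`.
  rw [LusinLpBound, ENNReal.rpow_sub _ _ he0 ENNReal.ofReal_ne_top, ENNReal.rpow_one] at hb
  calc eLpNorm (gradient u) p (volume.restrict Ω) / (ζ p * ψ p)
      ≤ K * (ENNReal.ofReal ε ^ (p⁻¹).toReal / ENNReal.ofReal ε) *
          eLpNorm f p (volume.restrict Ω) / (ζ p * ψ p) := by gcongr
    _ = K * (ENNReal.ofReal ε)⁻¹ * (ENNReal.ofReal ε ^ (p⁻¹).toReal / ζ p) *
          (eLpNorm f p (volume.restrict Ω) / ψ p) := by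
        simp only [div_eq_mul_inv]
        rw [ENNReal.mul_inv (Or.inl (hne hζ p hpI)) (Or.inr (hne hψ p hpI))]
        ring
    _ ≤ _ := by
        gcongr
        · exact le_iSup₂ (f := fun p (_ : p ∈ {p | ζ p < ∞}) =>
            ENNReal.ofReal ε ^ (p⁻¹).toReal / ζ p) p hζp
        · exact le_iSup₂ (f := fun p (_ : p ∈ {p | ψ p < ∞}) =>
            eLpNorm f p (volume.restrict Ω) / ψ p) p hψp

open Classical in
theorem isPsiFunction_ite {a b : ℝ≥0∞} (h1 : 1 ≤ a) (hab : a < b) {χ : ℝ≥0∞ → ℝ≥0∞}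
    (hc : ContinuousOn χ (Ioo a b)) (hfin : ∀ p ∈ Ioo a b, χ p < ∞) {c : ℝ≥0∞} (hc0 : 0 < c)
    (hle : ∀ p ∈ Ioo a b, c ≤ χ p) :
    IsPsiFunction a b (fun p => if p ∈ Ioo a b then χ p else ∞) := by
  refine ⟨h1, hab, ?_, hc.congr fun p hp => if_pos hp, hc0.trans_le (le_iInf₂ fun p hp => ?_)⟩
  · ext p
    by_cases hp : p ∈ Ioo a b
    · refine iff_of_true ?_ hp
      rw [mem_ofPred_eq, if_pos hp]
      exact hfin p hp
    · refine iff_of_false ?_ hp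
      rw [mem_ofPred_eq, if_neg hp]
      exact lt_irrefl _
  · rw [if_pos hp]; exact hle p hp

/-- The open unit cube. -/
theorem exists_isOpen_volume_eq_one (d : ℕ) :
    ∃ Ω : Set (EuclideanSpace ℝ (Fin d)), IsOpen Ω ∧ volume Ω = 1 := by
  refine ⟨WithLp.ofLp ⁻¹' univ.pi fun _ => Ioo (0 : ℝ) 1,
    (isOpen_set_pi finite_univ fun _ _ => isOpen_Ioo).preimage (PiLp.continuous_ofLp 2 _), ?_⟩
  rw [(PiLp.volume_preserving_ofLp (Fin d)).measure_preimage
    (MeasurableSet.univ_pi fun _ => measurableSet_Ioo).nullMeasurableSet, volume_pi_pi]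
  simp

/-- Take `f` a constant unit vector on a set of measure 1, ψ = 1 and ζ(p) = ε^(1/p) on (1, 2). Both
factors on the left are then at most 1, while |Du|_p ≥ |Du|_1 ≥ 2(1 - ε) and 1/ζ(p) → 1/ε as p → 1.
-/
theorem exists_glsNorm_gradient_gt {d : ℕ} (hd : 1 ≤ d) {K : ℝ≥0∞} (hK : K < 2) :
    ∃ (Ω : Set (EuclideanSpace ℝ (Fin d)))
      (f : EuclideanSpace ℝ (Fin d) → EuclideanSpace ℝ (Fin d)) (ε : ℝ)
      (a b : ℝ≥0∞) (ψ ζ : ℝ≥0∞ → ℝ≥0∞),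
      IsOpen Ω ∧ volume Ω < ∞ ∧ Measurable (Ω.domRestrict f) ∧ 0 < ε ∧
      IsPsiFunction a b ψ ∧ IsPsiFunction a b ζ ∧
      glsNorm (volume.restrict Ω) ψ f < ∞ ∧
      ∀ A u, IsLusinPair Ω f ε A u →
        K * (ENNReal.ofReal ε)⁻¹ * glsFundamental ζ (ENNReal.ofReal ε) *
            glsNorm (volume.restrict Ω) ψ f <
          glsNorm (volume.restrict Ω) (fun p => ζ p * ψ p) (gradient u) := by
  classical
  obtain ⟨Ω, hΩ, hvol⟩ := exists_isOpen_volume_eq_one d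
  have : IsProbabilityMeasure (volume.restrict Ω) := ⟨by simpa using hvol⟩
  let v : EuclideanSpace ℝ (Fin d) := EuclideanSpace.single ⟨0, hd⟩ 1
  have hv : ‖v‖ = 1 := by simp [v]
  have hKt : K ≠ ∞ := (hK.trans_le le_top).ne
  set k := K.toReal with hk
  have hk0 : 0 ≤ k := ENNReal.toReal_nonneg
  have hk2 : k < 2 := by
    rw [hk, ← ENNReal.toReal_ofNat 2]
    exact (ENNReal.toReal_lt_toReal hKt (by simp)).2 hK
  have hKk : K = ENNReal.ofReal k := (ENNReal.ofReal_toReal hKt).symm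
  -- Makes 2(1 - ε) = 1 + k/2, which exceeds `k` because k < 2.
  set ε := (2 - k) / 4 with hε
  have h0 : 0 < ε := by rw [hε]; linarith
  have h1 : ε < 1 := by rw [hε]; linarith
  have hKε : K < ENNReal.ofReal (2 * (1 - ε)) := by
    rw [hKk]
    exact (ENNReal.ofReal_lt_ofReal_iff (by linarith)).2 (by rw [hε]; linarith)
  set e := ENNReal.ofReal ε
  have he0 : e ≠ 0 := (ENNReal.ofReal_pos.2 h0).ne'
  have het : e ≠ ∞ := ENNReal.ofReal_ne_top
  have he1 : e ≤ 1 := ENNReal.ofReal_le_one.2 h1.le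
  let χ : ℝ≥0∞ → ℝ≥0∞ := fun p => e ^ (p⁻¹).toReal
  have hχc : ∀ p, 1 ≤ p → ContinuousAt χ p := by
    intro p hp
    have hp0 : p⁻¹ ≠ ∞ := ENNReal.inv_ne_top.2 (zero_lt_one.trans_le hp).ne'
    have c1 : ContinuousAt (fun p : ℝ≥0∞ => (p⁻¹).toReal) p :=
      (ENNReal.continuousAt_toReal hp0).comp continuous_inv.continuousAt
    have c2 : Continuous fun s : ℝ => e ^ s := by
      have : (fun s : ℝ => e ^ s) = fun s : ℝ => ENNReal.ofReal (ε ^ s) := by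
        ext1 s
        exact ENNReal.ofReal_rpow_of_pos h0
      rw [this]
      exact ENNReal.continuous_ofReal.comp (Real.continuous_const_rpow h0.ne')
    exact c2.continuousAt.comp c1
  have hχt : ∀ p, χ p ≠ ∞ := fun p => ENNReal.rpow_ne_top_of_ne_zero he0 het
  have hχ0 : ∀ p, χ p ≠ 0 := fun p => (ENNReal.rpow_pos (pos_iff_ne_zero.2 he0) het).ne'
  have hχle : ∀ p, 1 ≤ p → e ≤ χ p := by
    intro p hp
    calc e = e ^ (1 : ℝ) := (ENNReal.rpow_one e).symm
      _ ≤ _ := by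
        refine ENNReal.rpow_le_rpow_of_exponent_ge he1 ?_
        rw [← ENNReal.toReal_one]
        exact ENNReal.toReal_mono ENNReal.one_ne_top (ENNReal.inv_le_one.2 hp)
  let ψ : ℝ≥0∞ → ℝ≥0∞ := fun p => if p ∈ Ioo (1 : ℝ≥0∞) 2 then (1 : ℝ≥0∞) else ∞
  let ζ : ℝ≥0∞ → ℝ≥0∞ := fun p => if p ∈ Ioo (1 : ℝ≥0∞) 2 then χ p else ∞
  have h12 : (1 : ℝ≥0∞) < 2 := ENNReal.one_lt_two
  have hψ : IsPsiFunction 1 2 ψ := isPsiFunction_ite (χ := fun _ => 1) le_rfl h12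
    continuousOn_const (fun _ _ => ENNReal.one_lt_top) zero_lt_one fun _ _ => le_rfl
  have hζ : IsPsiFunction 1 2 ζ := isPsiFunction_ite le_rfl h12
    (fun p hp => (hχc p hp.1.le).continuousWithinAt) (fun p _ => lt_top_iff_ne_top.2 (hχt p))
    (pos_iff_ne_zero.2 he0) fun p hp => hχle p hp.1.le
  have hfnorm : glsNorm (volume.restrict Ω) ψ (fun _ => v) ≤ 1 := by
    refine iSup₂_le fun p hp => ?_
    have hpI : p ∈ Ioo (1 : ℝ≥0∞) 2 := hψ.supp_eq ▸ hp
    rw [eLpNorm_const _ (zero_lt_one.trans hpI.1).ne' (NeZero.ne _), ← ofReal_norm, hv]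
    simp [ψ, hpI.1, hpI.2]
  have hfund : glsFundamental ζ e ≤ 1 := by
    refine iSup₂_le fun p hp => ?_
    have hpI : p ∈ Ioo (1 : ℝ≥0∞) 2 := hζ.supp_eq ▸ hp
    simp only [ζ, if_pos hpI]
    exact ENNReal.div_self_le_one
  refine ⟨Ω, fun _ => v, ε, 1, 2, ψ, ζ, hΩ, by simp [hvol], measurable_const, h0, hψ, hζ,
    hfnorm.trans_lt ENNReal.one_lt_top, fun A u hAu => ?_⟩
  have hlow := hAu.two_mul_le_eLpNorm_one hv hΩ hvol h0 h1
  have hlim : ENNReal.ofReal (2 * (1 - ε)) * e⁻¹ ≤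
      glsNorm (volume.restrict Ω) (fun p => ζ p * ψ p) (gradient u) := by
    -- The exponent 1 is outside the open interval, so the `L_1` bound is reached only as a limit
    -- from the right.
    have t1 : Filter.Tendsto (fun p => ENNReal.ofReal (2 * (1 - ε)) * (χ p)⁻¹)
        (nhdsWithin 1 (Ioi 1)) (nhds (ENNReal.ofReal (2 * (1 - ε)) * e⁻¹)) := by
      have t2 : Filter.Tendsto χ (nhds 1) (nhds e) := by
        have := hχc 1 le_rfl
        simpa [ContinuousAt, χ] using this
      exact (ENNReal.Tendsto.const_mul (tendsto_inv_iff.2 t2)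
        (Or.inr ENNReal.ofReal_ne_top)).mono_left nhdsWithin_le_nhds
    have : (nhdsWithin (1 : ℝ≥0∞) (Ioi 1)).NeBot := nhdsGT_neBot_of_exists_gt ⟨2, h12⟩
    refine le_of_tendsto t1 ?_
    filter_upwards [Ioo_mem_nhdsGT h12] with p hp
    have hpν : p ∈ {p | ζ p * ψ p < ∞} := by
      simp only [mem_ofPred_eq, ζ, ψ, if_pos hp, mul_one]
      exact lt_top_iff_ne_top.2 (hχt p)
    calc ENNReal.ofReal (2 * (1 - ε)) * (χ p)⁻¹
        ≤ eLpNorm (gradient u) p (volume.restrict Ω) * (χ p)⁻¹ := by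
          gcongr
          exact hlow.trans (eLpNorm_le_eLpNorm_of_exponent_le hp.1.le
            hAu.contDiff.continuous_gradient.aestronglyMeasurable)
      _ = eLpNorm (gradient u) p (volume.restrict Ω) / (ζ p * ψ p) := by
          simp only [ζ, ψ, if_pos hp, mul_one, div_eq_mul_inv]
      _ ≤ _ := le_iSup₂ (f := fun p (_ : p ∈ {p | ζ p * ψ p < ∞}) =>
            eLpNorm (gradient u) p (volume.restrict Ω) / (ζ p * ψ p)) p hpν
  calc K * e⁻¹ * glsFundamental ζ e * glsNorm (volume.restrict Ω) ψ (fun _ => v)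
      ≤ K * e⁻¹ * 1 * 1 := by gcongr
    _ = K * e⁻¹ := by ring
    _ < ENNReal.ofReal (2 * (1 - ε)) * e⁻¹ :=
        ENNReal.mul_lt_mul_left (ENNReal.inv_ne_zero.2 het) (ENNReal.inv_ne_top.2 he0) hKε
    _ ≤ _ := hlim

/-- The optimal constant is `2` in every dimension. -/
theorem lusinConst_eq_two {d : ℕ} (hd : 1 ≤ d) : lusinConst d = 2 := by
  refine le_antisymm (sInf_le fun Ω f ε hΩ hfin hf h0 =>
    exists_isLusinPair_bound_two hΩ hfin hf h0) (le_sInf fun K hK => ?_)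
  by_contra! hlt
  -- A smaller constant in the `L_p` estimates would give the Grand Lebesgue estimate with that
  -- constant, contradicting the example.
  obtain ⟨Ω, f, ε, a, b, ψ, ζ, hΩ, hfin, hf, h0, hψ, hζ, -, hgt⟩ :=
    exists_glsNorm_gradient_gt hd hlt
  obtain ⟨A, u, hAu, hb⟩ := hK Ω f ε hΩ hfin hf h0
  exact (hgt A u hAu).not_ge (glsNorm_gradient_le h0 (fun p hp _ => hb p hp.le) hψ hζ)

theorem theorem2p1 (d : ℕ) (hd : 1 ≤ d) :
    (0 < lusinConst d ∧ lusinConst d < ∞) ∧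
    -- solutions with the constant `K(d)` exist, and each of them obeys the Grand Lebesgue estimate
    (∀ (Ω : Set (EuclideanSpace ℝ (Fin d)))
      (f : EuclideanSpace ℝ (Fin d) → EuclideanSpace ℝ (Fin d)) (ε : ℝ),
      IsOpen Ω → volume Ω < ∞ → Measurable (Ω.domRestrict f) → 0 < ε →
      (∃ A u, IsLusinPair Ω f ε A u ∧ ∀ p, 1 ≤ p → LusinLpBound (lusinConst d) Ω f ε u p) ∧
      (∀ A u, IsLusinPair Ω f ε A u →
        (∀ p, 1 < p → p < ∞ → LusinLpBound (lusinConst d) Ω f ε u p) →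
        ∀ (a b : ℝ≥0∞) (ψ ζ : ℝ≥0∞ → ℝ≥0∞), IsPsiFunction a b ψ → IsPsiFunction a b ζ →
          glsNorm (volume.restrict Ω) ψ f < ∞ →
          glsNorm (volume.restrict Ω) (fun p => ζ p * ψ p) (gradient u) ≤
            lusinConst d * (ENNReal.ofReal ε)⁻¹ * glsFundamental ζ (ENNReal.ofReal ε) *
              glsNorm (volume.restrict Ω) ψ f)) ∧
    -- no smaller constant will do, even if `A` and `u` may be chosen depending on `ψ` and `ζ`
    (∀ K : ℝ≥0∞, K < lusinConst d →
      ∃ (Ω : Set (EuclideanSpace ℝ (Fin d)))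
        (f : EuclideanSpace ℝ (Fin d) → EuclideanSpace ℝ (Fin d)) (ε : ℝ)
        (a b : ℝ≥0∞) (ψ ζ : ℝ≥0∞ → ℝ≥0∞),
        IsOpen Ω ∧ volume Ω < ∞ ∧ Measurable (Ω.domRestrict f) ∧ 0 < ε ∧
        IsPsiFunction a b ψ ∧ IsPsiFunction a b ζ ∧
        glsNorm (volume.restrict Ω) ψ f < ∞ ∧
        ∀ A u, IsLusinPair Ω f ε A u →
          K * (ENNReal.ofReal ε)⁻¹ * glsFundamental ζ (ENNReal.ofReal ε) *
              glsNorm (volume.restrict Ω) ψ f <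
            glsNorm (volume.restrict Ω) (fun p => ζ p * ψ p) (gradient u)) := by
  rw [lusinConst_eq_two hd]
  refine ⟨⟨by norm_num, by norm_num⟩, fun Ω f ε hΩ hfin hf h0 =>
    ⟨exists_isLusinPair_bound_two hΩ hfin hf h0, fun A u _ hb a b ψ ζ hψ hζ _ =>
      glsNorm_gradient_le h0 hb hψ hζ⟩, fun K hK => exists_glsNorm_gradient_gt hd hK⟩
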